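/- Let $\mathbf Y=\boldsymbol\theta+\boldsymbol\varepsilon\in\mathbb R^n$, where $\varepsilon_1,\dots,\varepsilon_n$ are independent mean-zero random variables with $\mathbb E[e^{s\varepsilon_i}]\le e^{s^2/2}$ for all $s\in\mathbb R$, and where $\boldsymbol\theta$ has exactly $K$ change-points: there are integers $1=\tau^*_0<\tau^*_1<\dots<\tau^*_K<\tau^*_{K+1}=n+1$ and reals $\mu_1,\dots,\mu_{K+1}$ with $\mu_k\neq\mu_{k+1}$ such that $\theta_i=\mu_k$ for $\tau^*_{k-1}\le i<\tau^*_k$. Put $\Delta_k=\mu_{k+1}-\mu_k$. For integers $1\le t_1<t_2<t_3\le n+1$, $\mathbf t=(t_1,t_2,t_3)$, and $x\in\mathbb R^n$ let $$\mathbf C(x,\mathbf t)=\Big[\tfrac{1}{t_3-t_2}\sum_{i=t_2}^{t_3-1}x_i-\tfrac1{t_2-t_1}\sum_{i=t_1}^{t_2-1}x_i\Big]\sqrt{\tfrac{(t_2-t_1)(t_3-t_2)}{t_3-t_1}},\qquad \psi_q(\mathbf t)=\sqrt{2\log\tfrac{n(t_3-t_1)}{(t_3-t_2)(t_2-t_1)}+q},$$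 and $\mathbf E(\boldsymbol\theta,\mathbf t)=|\mathbf C(\boldsymbol\theta,\mathbf t)|$. A change-point vector is $\boldsymbol\tau=(\tau_1<\dots<\tau_m)$ with entries in $\{2,\dots,n\}$, $m=|\boldsymbol\tau|\ge 0$, with the conventions $\tau_0=1$, $\tau_{m+1}=n+1$. An entry $\tau_l$ of $\boldsymbol\tau$ is called $(\kappa,q,\boldsymbol\tau)$-high-energy if $\mathbf E(\boldsymbol\theta,\mathbf t)>\kappa\,\psi_q(\mathbf t)$ for $\mathbf t=(\tau_{l-1},\tau_l,\tau_{l+1})$; a $(\kappa,q,\boldsymbol\tau^*)$-high-energy change-point $\tau^*_k$ is simply called $(\kappa,q)$-high-energy. For $L,q>0$, let $\widehat{\boldsymbol\tau}$ be any minimizer, over all change-point vectors $\boldsymbol\tau$, of $$\|\mathbf Y-\Pi_{\boldsymbol\tau}\mathbf Y\|^2+L\,\mathrm{pen}_0(\boldsymbol\tau,q),\qquad \mathrm{pen}_0(\boldsymbol\tau,q)=q|\boldsymbol\tau|+2\sum_{i=1}^{|\boldsymbol\tau|+1}\log\frac{n}{\tau_i-\tau_{i-1}},$$ where $\Pi_{\boldsymbol\tau}$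 is the orthogonal projection onto the vectors that are constant on each $\{\tau_i,\dots,\tau_{i+1}-1\}$, $0\le i\le|\boldsymbol\tau|$. Let $$\mathcal A_q=\big\{|\mathbf C(\boldsymbol\varepsilon,\mathbf t)|\le 2\psi_q(\mathbf t)\ \text{ for all } 1\le t_1<t_2<t_3\le n+1\big\}.$$ **Proposition 4.** There exist universal constants $c,c'>0$, $L_0$, $q_0$, $n_0$ and, for every $L\ge L_0$, a constant $\kappa_L>1$ depending only on $L$, such that for all $L\ge L_0$, $q>q_0$, $n>n_0$, $K\geq 1$ and all $\boldsymbol\theta\in\mathbb R^n$ with exactly $K$ change-points (with no condition on their energies), the event $\mathcal A_q$ has probability at least $1-ce^{-c'q}$, and on $\mathcal A_q$ every such $\widehat{\boldsymbol\tau}$ satisfies: (a) (NoSp) for each $k\in\{1,\dots,K\}$, at most one entry of $\widehat{\boldsymbol\tau}$ lies in the interval $\big(\tfrac{\tau^*_{k-1}+\tau^*_k}2,\tfrac{\tau^*_k+\tau^*_{k+1}}2\big]$, where for $k=1$ the left end is replaced by the closed end $2$ and for $k=K$ the right end is replaced by $n$ (so that the interval is $[2,n]$ if $K=1$); (b) (Detec)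 for each $k\in\{1,\dots,K\}$ such that $\tau^*_k$ is a $(\kappa_L,q)$-high-energy change-point, $\widehat{\boldsymbol\tau}$ is non-empty and $$\min_{l}|\widehat\tau_l-\tau^*_k|\le\min\Big\{\tfrac{\tau^*_{k+1}-\tau^*_k}2,\ \tfrac{\tau^*_k-\tau^*_{k-1}}2,\ \kappa_L\tfrac{\log(n\Delta_k^2)+q}{\Delta_k^2}\Big\};$$ (c) for each $k\in\{1,\dots,K\}$, either $\tau^*_k$ is an entry of $\widehat{\boldsymbol\tau}$, or $\tau^*_k$ is not a $(\sqrt L+2,\,q,\,\widehat{\boldsymbol\tau}^{(k)})$-high-energy change-point, where $\widehat{\boldsymbol\tau}^{(k)}$ is the change-point vector obtained by inserting $\tau^*_k$ into $\widehat{\boldsymbol\tau}$. -/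

import Mathlib

open MeasureTheory ProbabilityTheory

noncomputable section

namespace ChangePoint

/-- Sum of the coordinates of `x` at times `a, a+1, …, b-1`; the times are `1, …, n`, and the
coordinate `i : Fin n` is the observation at time `i + 1`. -/
def segSum {n : ℕ} (x : Fin n → ℝ) (a b : ℕ) : ℝ :=
  ∑ i ∈ Finset.univ.filter (fun i : Fin n => a ≤ (i : ℕ) + 1 ∧ (i : ℕ) + 1 < b), x i

/-- The CUSUM statistic of `x` at the triad `(t₁, t₂, t₃)`: the weighted difference of the means of
`x` on `[t₂, t₃)` and on `[t₁, t₂)`. -/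
def cusum {n : ℕ} (x : Fin n → ℝ) (t₁ t₂ t₃ : ℕ) : ℝ :=
  (segSum x t₂ t₃ / ((t₃ : ℝ) - t₂) - segSum x t₁ t₂ / ((t₂ : ℝ) - t₁)) *
    √(((t₂ : ℝ) - t₁) * ((t₃ : ℝ) - t₂) / ((t₃ : ℝ) - t₁))

/-- The energy of `θ` at the triad `(t₁, t₂, t₃)`. -/
def energy {n : ℕ} (θ : Fin n → ℝ) (t₁ t₂ t₃ : ℕ) : ℝ := |cusum θ t₁ t₂ t₃|

/-- The multiscale threshold `√(2 log (n (t₃ - t₁) / ((t₃ - t₂) (t₂ - t₁))) + q)`. -/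
def threshold (n : ℕ) (q : ℝ) (t₁ t₂ t₃ : ℕ) : ℝ :=
  √(2 * Real.log ((n : ℝ) * ((t₃ : ℝ) - t₁) / (((t₃ : ℝ) - t₂) * ((t₂ : ℝ) - t₁))) + q)

/-- The middle point of the triad `(t₁, t₂, t₃)` has `(κ, q)`-high energy. -/
def IsHighEnergy {n : ℕ} (θ : Fin n → ℝ) (κ q : ℝ) (t₁ t₂ t₃ : ℕ) : Prop :=
  κ * threshold n q t₁ t₂ t₃ < energy θ t₁ t₂ t₃

/-- `θ` is the vector with exactly `K` change-points, at `τ 1 < ⋯ < τ K`, with the conventions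
`τ 0 = 1` and `τ (K + 1) = n + 1`; it takes the value `μ k` on `[τ (k - 1), τ k)`, and consecutive
values are distinct. Only `τ 0, …, τ (K + 1)` and `μ 1, …, μ (K + 1)` matter. -/
structure HasChangePoints {n : ℕ} (θ : Fin n → ℝ) (K : ℕ) (τ : ℕ → ℕ) (μ : ℕ → ℝ) : Prop where
  first : τ 0 = 1
  last : τ (K + 1) = n + 1
  lt_succ : ∀ k ≤ K, τ k < τ (k + 1)
  ne_succ : ∀ k ∈ Finset.Icc 1 K, μ k ≠ μ (k + 1)
  value : ∀ k ∈ Finset.Icc 1 (K + 1), ∀ i : Fin n,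
    τ (k - 1) ≤ (i : ℕ) + 1 → (i : ℕ) + 1 < τ k → θ i = μ k

/-! A change-point vector `1 < τ₁ < ⋯ < τ_m < n + 1` is represented by the set of its entries, a
subset of `{2, …, n}`, with the conventions `τ₀ = 1` and `τ_{m+1} = n + 1`. -/

/-- The element of `{1} ∪ τ` that precedes `t` (for `1 < t`). -/
def prevPoint (τ : Finset ℕ) (t : ℕ) : ℕ := ((insert 1 τ).filter (· < t)).sup id

/-- The element of `τ ∪ {n + 1}` that follows `t` (for `t ≤ n`). -/
def nextPoint (n : ℕ) (τ : Finset ℕ) (t : ℕ) : ℕ := sInf {u | u ∈ insert (n + 1) τ ∧ t < u}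

/-- The entry `t` of the change-point vector `τ` is a `(κ, q, τ)`-high-energy change-point. -/
def IsHighEnergyIn {n : ℕ} (θ : Fin n → ℝ) (κ q : ℝ) (τ : Finset ℕ) (t : ℕ) : Prop :=
  IsHighEnergy θ κ q (prevPoint τ t) t (nextPoint n τ t)

/-- The space of vectors that are constant on each segment `[τ_i, τ_{i+1})`, `0 ≤ i ≤ |τ|`. -/
def piecewiseConst (n : ℕ) (τ : Finset ℕ) : Submodule ℝ (EuclideanSpace ℝ (Fin n)) where
  carrier := {x | ∀ a ∈ insert 1 τ, ∀ i j : Fin n,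
    a ≤ (i : ℕ) + 1 → (i : ℕ) + 1 < nextPoint n τ a →
    a ≤ (j : ℕ) + 1 → (j : ℕ) + 1 < nextPoint n τ a → x i = x j}
  add_mem' := by
    intro x y hx hy a ha i j h1 h2 h3 h4
    simp only [PiLp.add_apply, hx a ha i j h1 h2 h3 h4, hy a ha i j h1 h2 h3 h4]
  zero_mem' := by
    intro a ha i j h1 h2 h3 h4
    rfl
  smul_mem' := by
    intro r x hx a ha i j h1 h2 h3 h4
    simp only [PiLp.smul_apply, hx a ha i j h1 h2 h3 h4]

/-- The multiscale penalty `q |τ| + 2 ∑ log (n / (τ_{i+1} - τ_i))`, the sum over the `|τ| + 1`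
segments of `τ`. -/
def pen (n : ℕ) (q : ℝ) (τ : Finset ℕ) : ℝ :=
  q * (τ.card : ℝ) + 2 * ∑ a ∈ insert 1 τ, Real.log ((n : ℝ) / ((nextPoint n τ a : ℝ) - a))

/-- The penalized least-squares criterion `‖Y - Π_τ Y‖² + L pen(τ, q)`, where `Π_τ` is the
orthogonal projection onto `piecewiseConst n τ`. -/
def crit {n : ℕ} (L q : ℝ) (Y : Fin n → ℝ) (τ : Finset ℕ) : ℝ :=
  ‖WithLp.toLp 2 Y - (piecewiseConst n τ).starProjection (WithLp.toLp 2 Y)‖ ^ 2 + L * pen n q τ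

/-- `τ` is a penalized least-squares estimate: a minimizer of the criterion over all change-point
vectors. -/
def IsPenalizedLSE {n : ℕ} (L q : ℝ) (Y : Fin n → ℝ) (τ : Finset ℕ) : Prop :=
  τ ⊆ Finset.Icc 2 n ∧ ∀ τ' ⊆ Finset.Icc 2 n, crit L q Y τ ≤ crit L q Y τ'

/-- The noise model: independent, mean-zero random variables with
`𝔼[exp (s ε_i)] ≤ exp (s² / 2)` for all real `s`. -/
structure IsNoise {Ω : Type*} [MeasurableSpace Ω] (P : Measure Ω) {n : ℕ}
    (ε : Fin n → Ω → ℝ) : Prop where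
  measurable : ∀ i, Measurable (ε i)
  indep : iIndepFun ε P
  mean_zero : ∀ i, ∫ ω, ε i ω ∂P = 0
  subgaussian : ∀ i, HasSubgaussianMGF (ε i) 1 P

/-- The event on which the noise is uniformly controlled over all triads
`1 ≤ t₁ < t₂ < t₃ ≤ n + 1`. -/
def noiseEvent {Ω : Type*} {n : ℕ} (ε : Fin n → Ω → ℝ) (q : ℝ) : Set Ω :=
  {ω | ∀ t₁ t₂ t₃ : ℕ, 1 ≤ t₁ → t₁ < t₂ → t₂ < t₃ → t₃ ≤ n + 1 →
    |cusum (fun i => ε i ω) t₁ t₂ t₃| ≤ 2 * threshold n q t₁ t₂ t₃}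

/-- No spurious change-point: for each `k`, the cell
`((τ*_{k-1} + τ*_k) / 2, (τ*_k + τ*_{k+1}) / 2]` contains at most one point of `τ`; the first cell
is extended on the left to `2`, and the last one on the right to `n`, so that the cells cover
`{2, …, n}`. -/
def NoSp (K : ℕ) (τs : ℕ → ℕ) (τ : Finset ℕ) : Prop :=
  ∀ k ∈ Finset.Icc 1 K,
    {u ∈ (τ : Set ℕ) | (k = 1 ∨ ((τs (k - 1) : ℝ) + τs k) / 2 < u) ∧
      (k = K ∨ (u : ℝ) ≤ ((τs k : ℝ) + τs (k + 1)) / 2)}.ncard ≤ 1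

/-- Every `(κ, q)`-high-energy change-point `τ*_k`, of height `Δ_k = μ_{k+1} - μ_k`, is at distance
at most `min ((τ*_{k+1} - τ*_k) / 2) ((τ*_k - τ*_{k-1}) / 2) (c (log (n Δ_k²) + q) / Δ_k²)` from the
set `τ`. Since `τ` is finite, this says that some point of `τ` is within that distance; in
particular `τ` is not empty. -/
def Detec {n : ℕ} (θ : Fin n → ℝ) (K : ℕ) (τs : ℕ → ℕ) (μ : ℕ → ℝ) (κ q c : ℝ)
    (τ : Finset ℕ) : Prop :=
  ∀ k ∈ Finset.Icc 1 K, IsHighEnergy θ κ q (τs (k - 1)) (τs k) (τs (k + 1)) →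
    ∃ t ∈ τ, |(t : ℝ) - τs k| ≤
      min (((τs (k + 1) : ℝ) - τs k) / 2)
        (min (((τs k : ℝ) - τs (k - 1)) / 2)
          (c * (Real.log (n * (μ (k + 1) - μ k) ^ 2) + q) / (μ (k + 1) - μ k) ^ 2))

end ChangePoint

end

/-! Write `T` for the square of the threshold `ψ`. Inserting a point `t` between two consecutive
entries `t₁ < t₃` of a change-point vector changes the criterion by
`L T (t₁, t, t₃) - C (Y, (t₁, t, t₃))²`, so a minimizer can be compared with the
vectors obtained by inserting, removing or moving a few entries. Inserting a missed change-point
gives (c). If a high-energy change-point is far from all entries, inserting it together with at most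
two points around it lowers the criterion, which gives (b).

For (a), a minimizer only keeps an entry whose squared statistic is at least of the order of `L T`,
whereas it is at most `4 T` at an entry inside a piece on which `θ` is constant, and `L` is large.
So two entries in the cell of a change-point `s` enclose it, and their statistics come from the same
jump at `s`: then inserting `s` while removing the two entries, or moving them away from `s`, lowers
the criterion.

The probability of the noise event is bounded by a union bound over short unions of adjacent dyadic
segments, followed by a chaining argument that transfers the control to all segments. -/

noncomputable section

namespace ChangePoint

/-! ### Sums over segments -/

section Segments

variable {n : ℕ}

/-- `x` takes the value `r` on the segment `[a, b)`. -/
def ConstOn (x : Fin n → ℝ) (r : ℝ) (a b : ℕ) : Prop :=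
  ∀ i : Fin n, a ≤ (i : ℕ) + 1 → (i : ℕ) + 1 < b → x i = r

theorem ConstOn.mono {x : Fin n → ℝ} {r : ℝ} {a b a' b' : ℕ} (h : ConstOn x r a b)
    (ha : a ≤ a') (hb : b' ≤ b) : ConstOn x r a' b' :=
  fun i hi hi' => h i (ha.trans hi) (hi'.trans_le hb)

theorem segSum_self (x : Fin n → ℝ) (a : ℕ) : segSum x a a = 0 :=
  Finset.sum_eq_zero fun i hi => by
    have := (Finset.mem_filter.1 hi).2
    omega

theorem segSum_add_segSum (x : Fin n → ℝ) {a b c : ℕ} (hab : a ≤ b) (hbc : b ≤ c) :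
    segSum x a b + segSum x b c = segSum x a c := by
  unfold segSum
  rw [← Finset.sum_union]
  · congr 1
    ext i
    simp only [Finset.mem_union, Finset.mem_filter, Finset.mem_univ, true_and]
    omega
  · rw [Finset.disjoint_left]
    intro i
    simp only [Finset.mem_filter, Finset.mem_univ, true_and]
    omega

theorem segSum_add (x y : Fin n → ℝ) (a b : ℕ) :
    segSum (fun i => x i + y i) a b = segSum x a b + segSum y a b :=
  Finset.sum_add_distrib

theorem map_segment {a b : ℕ} (ha : 1 ≤ a) (hb : b ≤ n + 1) :
    (Finset.univ.filter fun i : Fin n => a ≤ (i : ℕ) + 1 ∧ (i : ℕ) + 1 < b).map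
      (Fin.valEmbedding.trans (addRightEmbedding 1)) = Finset.Ico a b := by
  ext k
  simp only [Finset.mem_map, Finset.mem_filter, Finset.mem_univ, true_and,
    Function.Embedding.trans_apply, Fin.valEmbedding_apply, addRightEmbedding_apply,
    Finset.mem_Ico]
  constructor
  · rintro ⟨i, hi, rfl⟩
    exact hi
  · exact fun hk => ⟨⟨k - 1, by omega⟩, by dsimp only; omega, by dsimp only; omega⟩

theorem segSum_eq_of_constOn {x : Fin n → ℝ} {r : ℝ} {a b : ℕ} (hx : ConstOn x r a b)
    (ha : 1 ≤ a) (hab : a ≤ b) (hb : b ≤ n + 1) : segSum x a b = ((b : ℝ) - a) * r := by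
  unfold segSum
  rw [Finset.sum_congr rfl fun i hi => hx i (Finset.mem_filter.1 hi).2.1
    (Finset.mem_filter.1 hi).2.2, Finset.sum_const, ← Finset.card_map, map_segment ha hb,
    Nat.card_Ico, nsmul_eq_mul, Nat.cast_sub hab]

theorem cusum_add (x y : Fin n → ℝ) (t₁ t₂ t₃ : ℕ) :
    cusum (fun i => x i + y i) t₁ t₂ t₃ = cusum x t₁ t₂ t₃ + cusum y t₁ t₂ t₃ := by
  unfold cusum
  rw [segSum_add, segSum_add]
  ring

theorem cusum_eq_of_jump {θ : Fin n → ℝ} {r₁ r₂ : ℝ} {a s b : ℕ} (ha : 1 ≤ a) (has : a < s)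
    (hsb : s < b) (hb : b ≤ n + 1) (h₁ : ConstOn θ r₁ a s) (h₂ : ConstOn θ r₂ s b) :
    cusum θ a s b = (r₂ - r₁) * √(((s : ℝ) - a) * ((b : ℝ) - s) / ((b : ℝ) - a)) := by
  have hx : (0 : ℝ) < (s : ℝ) - a := sub_pos.2 (Nat.cast_lt.2 has)
  have hy : (0 : ℝ) < (b : ℝ) - s := sub_pos.2 (Nat.cast_lt.2 hsb)
  unfold cusum
  rw [segSum_eq_of_constOn h₁ ha has.le (by omega), segSum_eq_of_constOn h₂ (by omega) hsb.le hb,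
    mul_div_cancel_left₀ _ hx.ne', mul_div_cancel_left₀ _ hy.ne']

theorem cusum_eq_zero_of_constOn {θ : Fin n → ℝ} {r : ℝ} {a s b : ℕ} (ha : 1 ≤ a)
    (has : a < s) (hsb : s < b) (hb : b ≤ n + 1) (h : ConstOn θ r a b) : cusum θ a s b = 0 := by
  rw [cusum_eq_of_jump ha has hsb hb (h.mono le_rfl hsb.le) (h.mono has.le le_rfl), sub_self,
    zero_mul]

end Segments

/-! ### Consecutive points of a change-point vector -/

/-- `u < w` are consecutive points of `{1} ∪ τ ∪ {n + 1}`, that is, `[u, w)` is one of the segments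
of the change-point vector `τ`. -/
structure Consec (n : ℕ) (τ : Finset ℕ) (u w : ℕ) : Prop where
  subset : τ ⊆ Finset.Icc 2 n
  left : u ∈ insert 1 τ
  right : w ∈ insert (n + 1) τ
  lt : u < w
  gap : ∀ x ∈ τ, u < x → w ≤ x

namespace Consec

variable {n : ℕ} {τ : Finset ℕ} {u w u' w' t : ℕ}

theorem one_le (h : Consec n τ u w) : 1 ≤ u := by
  rcases Finset.mem_insert.1 h.left with hu | hu
  · exact hu.ge
  · exact one_le_two.trans (Finset.mem_Icc.1 (h.subset hu)).1

theorem le_succ (h : Consec n τ u w) : w ≤ n + 1 := by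
  rcases Finset.mem_insert.1 h.right with hw | hw
  · exact hw.le
  · exact (Finset.mem_Icc.1 (h.subset hw)).2.trans n.le_succ

theorem n_pos (h : Consec n τ u w) : 0 < n := by
  have := h.one_le
  have := h.lt
  have := h.le_succ
  omega

theorem le_of_mem_left (h : Consec n τ u w) (ht : t ∈ insert 1 τ) (hut : u < t) : w ≤ t := by
  rcases Finset.mem_insert.1 ht with rfl | ht
  · exact absurd h.one_le (not_le.2 hut)
  · exact h.gap t ht hut

theorem eq_of_overlap (h : Consec n τ u w) (h' : Consec n τ u' w') (hu : u < w') (hu' : u' < w) :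
    u = u' ∧ w = w' := by
  have huu : u = u' := by
    rcases lt_trichotomy u u' with hlt | heq | hgt
    · exact absurd (h.le_of_mem_left h'.left hlt) (not_le.2 hu')
    · exact heq
    · exact absurd (h'.le_of_mem_left h.left hgt) (not_le.2 hu)
  have le_of_common_start : ∀ {v v' : ℕ}, Consec n τ u v → Consec n τ u v' → v ≤ v' := by
    intro v v' hv hv'
    rcases Finset.mem_insert.1 hv'.right with rfl | hmem
    · exact hv.le_succ
    · exact hv.gap v' hmem hv'.lt
  subst huu
  exact ⟨rfl, (le_of_common_start h h').antisymm (le_of_common_start h' h)⟩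

theorem of_nextPoint (hn : 0 < n) (hτ : τ ⊆ Finset.Icc 2 n) (hu : u ∈ insert 1 τ) :
    Consec n τ u (nextPoint n τ u) := by
  have hun : u < n + 1 := by
    rcases Finset.mem_insert.1 hu with rfl | h
    · omega
    · exact Nat.lt_succ_of_le (Finset.mem_Icc.1 (hτ h)).2
  have hmem := Nat.sInf_mem (s := {v | v ∈ insert (n + 1) τ ∧ u < v}) ⟨n + 1, by simp, hun⟩
  exact ⟨hτ, hu, hmem.1, hmem.2, fun x hx hux => Nat.sInf_le ⟨Finset.mem_insert_of_mem hx, hux⟩⟩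

theorem nextPoint_eq (h : Consec n τ u w) : nextPoint n τ u = w :=
  have hnext := of_nextPoint h.n_pos h.subset h.left
  (hnext.eq_of_overlap h h.lt hnext.lt).2

theorem prevPoint_eq (h : Consec n τ u w) (hu : u < t) (hw : t ≤ w) : prevPoint τ t = u := by
  refine le_antisymm (Finset.sup_le fun x hx => ?_)
    (Finset.le_sup (f := id) (Finset.mem_filter.2 ⟨h.left, hu⟩))
  rw [Finset.mem_filter] at hx
  exact not_lt.1 fun hux => (hw.trans (h.le_of_mem_left hx.1 hux)).not_gt hx.2

end Consec

section Existence

variable {n : ℕ} {τ : Finset ℕ} {t : ℕ}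

theorem exists_consec_lt_le (hτ : τ ⊆ Finset.Icc 2 n) (ht : 1 < t) (htn : t ≤ n + 1) :
    ∃ u w, Consec n τ u w ∧ u < t ∧ t ≤ w := by
  have hne : ((insert 1 τ).filter (· < t)).Nonempty :=
    ⟨1, Finset.mem_filter.2 ⟨Finset.mem_insert_self 1 τ, ht⟩⟩
  have hu := Finset.mem_filter.1 (Finset.max'_mem _ hne)
  have hc := Consec.of_nextPoint (by omega) hτ hu.1
  refine ⟨_, _, hc, hu.2, not_lt.1 fun hlt => ?_⟩
  rcases Finset.mem_insert.1 hc.right with h | h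
  · omega
  · exact (Finset.le_max' _ _ (Finset.mem_filter.2 ⟨Finset.mem_insert_of_mem h, hlt⟩)).not_gt hc.lt

theorem exists_consec_le_lt (hτ : τ ⊆ Finset.Icc 2 n) (ht : 1 ≤ t) (htn : t ≤ n) :
    ∃ u w, Consec n τ u w ∧ u ≤ t ∧ t < w := by
  obtain ⟨u, w, h, hu, hw⟩ := exists_consec_lt_le hτ (Nat.lt_succ_of_le ht) (Nat.succ_le_succ htn)
  exact ⟨u, w, h, Nat.lt_succ_iff.1 hu, hw⟩

theorem exists_consec_of_notMem (hτ : τ ⊆ Finset.Icc 2 n) (ht : t ∈ Finset.Icc 2 n)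
    (htτ : t ∉ τ) : ∃ u w, Consec n τ u w ∧ u < t ∧ t < w := by
  rw [Finset.mem_Icc] at ht
  obtain ⟨u, w, h, hu, hw⟩ := exists_consec_lt_le hτ (t := t) (by omega) (by omega)
  refine ⟨u, w, h, hu, hw.lt_of_ne ?_⟩
  rintro rfl
  rcases Finset.mem_insert.1 h.right with h' | h'
  · omega
  · exact htτ h'

theorem exists_consec_of_mem (hτ : τ ⊆ Finset.Icc 2 n) (ht : t ∈ τ) : ∃ u, Consec n τ u t := by
  have htn := Finset.mem_Icc.1 (hτ ht)
  obtain ⟨u, w, h, hu, hw⟩ := exists_consec_lt_le hτ (t := t) (by omega) (by omega)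
  exact ⟨u, (h.gap t ht hu).antisymm hw ▸ h⟩

end Existence

/-! ### Insertion of a point -/

namespace Consec

variable {n : ℕ} {τ : Finset ℕ} {u w t t₁ t₃ : ℕ}

theorem insert_subset (h : Consec n τ u w) (hu : u < t) (hw : t < w) :
    insert t τ ⊆ Finset.Icc 2 n := by
  have := h.one_le
  have := h.le_succ
  exact Finset.insert_subset (Finset.mem_Icc.2 ⟨by omega, by omega⟩) h.subset

theorem insert_left (h : Consec n τ u w) (hu : u < t) (hw : t < w) :
    Consec n (insert t τ) u t where
  subset := h.insert_subset hu hw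
  left := Finset.insert_subset_insert 1 (Finset.subset_insert t τ) h.left
  right := by simp
  lt := hu
  gap x hx hux := by
    rcases Finset.mem_insert.1 hx with rfl | hx
    · exact le_rfl
    · exact hw.le.trans (h.gap x hx hux)

theorem insert_right (h : Consec n τ u w) (hu : u < t) (hw : t < w) :
    Consec n (insert t τ) t w where
  subset := h.insert_subset hu hw
  left := by simp
  right := Finset.insert_subset_insert (n + 1) (Finset.subset_insert t τ) h.right
  lt := hw
  gap x hx htx := by
    rcases Finset.mem_insert.1 hx with rfl | hx
    · exact absurd htx (lt_irrefl x)
    · exact h.gap x hx (hu.trans htx)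

theorem insert_of_ne (h : Consec n τ t₁ t₃) (h₁ : t₁ < t) (h₃ : t < t₃) (huw : Consec n τ u w)
    (hu : u ≠ t₁) : Consec n (insert t τ) u w where
  subset := h.insert_subset h₁ h₃
  left := Finset.insert_subset_insert 1 (Finset.subset_insert t τ) huw.left
  right := Finset.insert_subset_insert (n + 1) (Finset.subset_insert t τ) huw.right
  lt := huw.lt
  gap x hx hux := by
    rcases Finset.mem_insert.1 hx with rfl | hx
    · by_contra hxw
      exact hu (huw.eq_of_overlap h (hux.trans h₃) (h₁.trans (not_le.1 hxw))).1
    · exact huw.gap x hx hux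

theorem sum_insert (h : Consec n τ t₁ t₃) (h₁ : t₁ < t) (h₃ : t < t₃) (F : ℕ → ℕ → ℝ) :
    ∑ a ∈ insert 1 (insert t τ), F a (nextPoint n (insert t τ) a) =
      ∑ a ∈ insert 1 τ, F a (nextPoint n τ a) + (F t₁ t + F t t₃ - F t₁ t₃) := by
  have ht : t ∉ insert 1 τ := fun ht => (h.le_of_mem_left ht h₁).not_gt h₃
  have hother : ∑ a ∈ (insert 1 τ).erase t₁, F a (nextPoint n (insert t τ) a) =
      ∑ a ∈ (insert 1 τ).erase t₁, F a (nextPoint n τ a) := by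
    refine Finset.sum_congr rfl fun a ha => ?_
    obtain ⟨hne, ha⟩ := Finset.mem_erase.1 ha
    rw [(insert_of_ne h h₁ h₃ (of_nextPoint h.n_pos h.subset ha) hne).nextPoint_eq]
  rw [Finset.insert_comm, Finset.sum_insert ht, (h.insert_right h₁ h₃).nextPoint_eq,
    ← Finset.add_sum_erase _ _ h.left, (h.insert_left h₁ h₃).nextPoint_eq, hother,
    ← Finset.add_sum_erase (insert 1 τ) _ h.left, h.nextPoint_eq]
  ring

end Consec

/-! ### The criterion as a sum over segments -/

section Criterion

variable {n : ℕ} {τ : Finset ℕ} {u w : ℕ}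

theorem sum_segSum_nextPoint (hn : 0 < n) (hτ : τ ⊆ Finset.Icc 2 n) (x : Fin n → ℝ) :
    ∑ a ∈ insert 1 τ, segSum x a (nextPoint n τ a) = ∑ i, x i := by
  have hconsec : ∀ i : Fin n, ∃ u w, Consec n τ u w ∧ u ≤ (i : ℕ) + 1 ∧ (i : ℕ) + 1 < w :=
    fun i => exists_consec_le_lt hτ (Nat.le_add_left 1 i) i.isLt
  choose u w h hu hw using hconsec
  rw [← Finset.sum_fiberwise_of_maps_to (g := u) fun i _ => (h i).left]
  refine Finset.sum_congr rfl fun _ ha => Finset.sum_congr (Finset.filter_congr fun i _ => ?_)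
    fun _ _ => rfl
  have ha' := Consec.of_nextPoint hn hτ ha
  constructor
  · rintro ⟨hai, hia⟩
    exact ((h i).eq_of_overlap ha' ((hu i).trans_lt hia) (hai.trans_lt (hw i))).1
  · rintro rfl
    exact ⟨hu i, (h i).nextPoint_eq ▸ hw i⟩

/-- The vector of the means of `x` over the segments of `τ`. The segment that contains the
coordinate `i` starts at `prevPoint τ (i + 2)`, since coordinates are numbered from `0` and
segments from `1`. -/
def segMean (τ : Finset ℕ) (x : Fin n → ℝ) (i : Fin n) : ℝ :=
  segSum x (prevPoint τ (i + 2)) (nextPoint n τ (prevPoint τ (i + 2))) /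
    ((nextPoint n τ (prevPoint τ (i + 2)) : ℝ) - prevPoint τ (i + 2))

theorem Consec.constOn_segMean (h : Consec n τ u w) (x : Fin n → ℝ) :
    ConstOn (segMean τ x) (segSum x u w / ((w : ℝ) - u)) u w := fun i hu hw => by
  unfold segMean
  rw [h.prevPoint_eq (t := i + 2) (by omega) (by omega), h.nextPoint_eq]

theorem segMean_mem_piecewiseConst (hn : 0 < n) (hτ : τ ⊆ Finset.Icc 2 n) (x : Fin n → ℝ) :
    WithLp.toLp 2 (segMean τ x) ∈ piecewiseConst n τ := fun _ ha i j hi hi' hj hj' =>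
  have h := (Consec.of_nextPoint hn hτ ha).constOn_segMean x
  (h i hi hi').trans (h j hj hj').symm

theorem segSum_mul_of_constOn {x y : Fin n → ℝ} {r : ℝ} (hy : ConstOn y r u w) :
    segSum (fun i => x i * y i) u w = segSum x u w * r := by
  unfold segSum
  rw [Finset.sum_mul]
  exact Finset.sum_congr rfl fun i hi => congrArg (x i * ·)
    (hy i (Finset.mem_filter.1 hi).2.1 (Finset.mem_filter.1 hi).2.2)

theorem inner_eq_sum_segSum (hn : 0 < n) (hτ : τ ⊆ Finset.Icc 2 n) (x y : Fin n → ℝ) :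
    inner ℝ (WithLp.toLp 2 x) (WithLp.toLp 2 y) =
      ∑ a ∈ insert 1 τ, segSum (fun i => x i * y i) a (nextPoint n τ a) := by
  rw [sum_segSum_nextPoint hn hτ]
  simp only [PiLp.inner_apply, RCLike.inner_apply, conj_trivial, mul_comm]

theorem Consec.segSum_segMean (h : Consec n τ u w) (x : Fin n → ℝ) :
    segSum (segMean τ x) u w = segSum x u w := by
  rw [segSum_eq_of_constOn (h.constOn_segMean x) h.one_le h.lt.le h.le_succ,
    mul_div_cancel₀ _ (sub_pos.2 (Nat.cast_lt.2 h.lt)).ne']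

theorem starProjection_piecewiseConst (hn : 0 < n) (hτ : τ ⊆ Finset.Icc 2 n) (x : Fin n → ℝ) :
    (piecewiseConst n τ).starProjection (WithLp.toLp 2 x) = WithLp.toLp 2 (segMean τ x) := by
  refine Submodule.eq_starProjection_of_mem_of_inner_eq_zero
    (segMean_mem_piecewiseConst hn hτ x) fun y hy => ?_
  rw [inner_sub_left, ← WithLp.toLp_ofLp 2 y, inner_eq_sum_segSum hn hτ,
    inner_eq_sum_segSum hn hτ, ← Finset.sum_sub_distrib]
  refine Finset.sum_eq_zero fun a ha => ?_
  have h := Consec.of_nextPoint hn hτ ha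
  have ha1 := h.one_le
  have hlt := h.lt
  have hle := h.le_succ
  have hconst : ConstOn y.ofLp (y ⟨a - 1, by omega⟩) a (nextPoint n τ a) := fun i hi hi' =>
    hy a ha i ⟨a - 1, by omega⟩ hi hi' (by dsimp only; omega) (by dsimp only; omega)
  rw [segSum_mul_of_constOn hconst, segSum_mul_of_constOn hconst, h.segSum_segMean, sub_self]

theorem norm_sq_sub_starProjection (hn : 0 < n) (hτ : τ ⊆ Finset.Icc 2 n) (x : Fin n → ℝ) :
    ‖WithLp.toLp 2 x - (piecewiseConst n τ).starProjection (WithLp.toLp 2 x)‖ ^ 2 =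
      ∑ i, x i ^ 2 -
        ∑ a ∈ insert 1 τ, segSum x a (nextPoint n τ a) ^ 2 / ((nextPoint n τ a : ℝ) - a) := by
  have horth := (piecewiseConst n τ).starProjection_inner_eq_zero (WithLp.toLp 2 x)
    _ (Submodule.starProjection_apply_mem _ (WithLp.toLp 2 x))
  rw [← real_inner_self_eq_norm_sq, inner_sub_right, horth, sub_zero, inner_sub_left,
    real_inner_self_eq_norm_sq, EuclideanSpace.real_norm_sq_eq,
    starProjection_piecewiseConst hn hτ, real_inner_comm, inner_eq_sum_segSum hn hτ]
  congr 1
  refine Finset.sum_congr rfl fun a ha => ?_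
  rw [segSum_mul_of_constOn ((Consec.of_nextPoint hn hτ ha).constOn_segMean x), sq, mul_div_assoc]

/-- The penalty `2 log (n / z) + q` of a segment of length `z`. -/
def segPen (n q z : ℝ) : ℝ := 2 * Real.log (n / z) + q

/-- The contribution of the segment `[u, w)` to the criterion. -/
def segCost (L q : ℝ) (Y : Fin n → ℝ) (u w : ℕ) : ℝ :=
  L * segPen n q ((w : ℝ) - u) - segSum Y u w ^ 2 / ((w : ℝ) - u)

theorem pen_eq_sum_segPen (q : ℝ) (hτ : τ ⊆ Finset.Icc 2 n) :
    pen n q τ = ∑ a ∈ insert 1 τ, segPen n q ((nextPoint n τ a : ℝ) - a) - q := by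
  have h1 : 1 ∉ τ := fun h => absurd (Finset.mem_Icc.1 (hτ h)).1 (by norm_num)
  unfold pen segPen
  rw [Finset.sum_add_distrib, ← Finset.mul_sum, Finset.sum_const, Finset.card_insert_of_notMem h1,
    nsmul_eq_mul]
  push_cast
  ring

theorem crit_eq_sum_segCost (L q : ℝ) (Y : Fin n → ℝ) (hn : 0 < n) (hτ : τ ⊆ Finset.Icc 2 n) :
    crit L q Y τ =
      ∑ i, Y i ^ 2 - L * q + ∑ a ∈ insert 1 τ, segCost L q Y a (nextPoint n τ a) := by
  unfold crit segCost
  rw [norm_sq_sub_starProjection hn hτ, pen_eq_sum_segPen q hτ, Finset.sum_sub_distrib,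
    ← Finset.mul_sum]
  ring

theorem crit_insert {t₁ t t₃ : ℕ} (L q : ℝ) (Y : Fin n → ℝ) (h : Consec n τ t₁ t₃) (h₁ : t₁ < t)
    (h₃ : t < t₃) :
    crit L q Y (insert t τ) =
      crit L q Y τ + (segCost L q Y t₁ t + segCost L q Y t t₃ - segCost L q Y t₁ t₃) := by
  rw [crit_eq_sum_segCost L q Y h.n_pos (h.insert_subset h₁ h₃),
    crit_eq_sum_segCost L q Y h.n_pos h.subset, h.sum_insert h₁ h₃]
  ring

/-- The square of the threshold, as a function of the lengths of the two segments. -/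
def thresholdSq (n q x y : ℝ) : ℝ := 2 * Real.log (n * (x + y) / (x * y)) + q

theorem segPen_add_segPen {m q x y : ℝ} (hm : 0 < m) (hx : 0 < x) (hy : 0 < y) :
    segPen m q x + segPen m q y = segPen m q (x + y) + thresholdSq m q x y := by
  have hlog : Real.log (m / x) + Real.log (m / y) =
      Real.log (m / (x + y)) + Real.log (m * (x + y) / (x * y)) := by
    rw [← Real.log_mul (by positivity) (by positivity),
      ← Real.log_mul (by positivity) (by positivity)]
    congr 1
    field_simp
  unfold segPen thresholdSq
  linarith

/-- The increase of the criterion caused by the insertion of `t` between the consecutive points `t₁`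
and `t₃`. -/
def insertCost (L q : ℝ) (Y : Fin n → ℝ) (t₁ t t₃ : ℕ) : ℝ :=
  L * thresholdSq n q ((t : ℝ) - t₁) ((t₃ : ℝ) - t) - cusum Y t₁ t t₃ ^ 2

theorem segCost_add_segCost (L q : ℝ) (Y : Fin n → ℝ) {t₁ t t₃ : ℕ} (hn : 0 < n) (h₁ : t₁ < t)
    (h₃ : t < t₃) :
    segCost L q Y t₁ t + segCost L q Y t t₃ = segCost L q Y t₁ t₃ + insertCost L q Y t₁ t t₃ := by
  have hx : (0 : ℝ) < (t : ℝ) - t₁ := sub_pos.2 (Nat.cast_lt.2 h₁)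
  have hy : (0 : ℝ) < (t₃ : ℝ) - t := sub_pos.2 (Nat.cast_lt.2 h₃)
  have hpen := segPen_add_segPen (q := q) (Nat.cast_pos.2 hn) hx hy
  have hxy : (t₃ : ℝ) - t₁ = ((t : ℝ) - t₁) + ((t₃ : ℝ) - t) := by ring
  unfold segCost insertCost cusum
  rw [hxy, mul_pow, Real.sq_sqrt (by positivity), ← segSum_add_segSum Y h₁.le h₃.le]
  rw [← eq_sub_iff_add_eq'] at hpen
  rw [hpen]
  generalize (t : ℝ) - t₁ = x at hx
  generalize (t₃ : ℝ) - t = y at hy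
  field_simp
  ring

end Criterion

/-! ### Optimality between two entries of a minimizer -/

section ChainCost

variable {n : ℕ}

/-- The total cost of the segments into which the points of a list cut `[u, w)`. -/
def chainCost (L q : ℝ) (Y : Fin n → ℝ) : ℕ → List ℕ → ℕ → ℝ
  | u, [], w => segCost L q Y u w
  | u, x :: l, w => segCost L q Y u x + chainCost L q Y x l w

theorem lt_of_isChain {l : List ℕ} {u w : ℕ} (h : (u :: (l ++ [w])).IsChain (· < ·)) :
    u < w ∧ ∀ x ∈ l, u < x ∧ x < w := by
  obtain ⟨hu, hl⟩ := List.pairwise_cons.1 (List.isChain_iff_pairwise.1 h)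
  exact ⟨hu w (by simp), fun x hx => ⟨hu x (by simp [hx]),
    (List.pairwise_append.1 hl).2.2 x hx w (List.mem_singleton_self w)⟩⟩

theorem crit_union_list (L q : ℝ) (Y : Fin n → ℝ) {t₃ : ℕ} (l : List ℕ) :
    ∀ {τ : Finset ℕ} {t₁ : ℕ}, Consec n τ t₁ t₃ → (t₁ :: (l ++ [t₃])).IsChain (· < ·) →
      l.toFinset ∪ τ ⊆ Finset.Icc 2 n ∧
      crit L q Y (l.toFinset ∪ τ) =
        crit L q Y τ + chainCost L q Y t₁ l t₃ - segCost L q Y t₁ t₃ := by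
  induction l with
  | nil =>
    intro τ t₁ h _
    simp [chainCost, h.subset]
  | cons x l ih =>
    intro τ t₁ h hl
    obtain ⟨hx₁, hx₃⟩ := (lt_of_isChain hl).2 x List.mem_cons_self
    rw [List.cons_append, List.isChain_cons_cons] at hl
    have hunion : (x :: l).toFinset ∪ τ = l.toFinset ∪ insert x τ := by
      rw [List.toFinset_cons, Finset.insert_union, Finset.union_insert]
    obtain ⟨hsub, hcrit⟩ := ih (h.insert_right hx₁ hx₃) hl.2
    rw [hunion, hcrit, crit_insert L q Y h hx₁ hx₃, chainCost]
    exact ⟨hsub, by ring⟩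

theorem Consec.sdiff {τ : Finset ℕ} {t₁ t₃ : ℕ} (s : Finset ℕ) (hτ : τ ⊆ Finset.Icc 2 n)
    (h₁ : t₁ ∈ insert 1 τ) (h₃ : t₃ ∈ insert (n + 1) τ) (hlt : t₁ < t₃)
    (hs : ∀ x ∈ s, t₁ < x ∧ x < t₃) (hgap : ∀ x ∈ τ, t₁ < x → x < t₃ → x ∈ s) :
    Consec n (τ \ s) t₁ t₃ where
  subset := Finset.sdiff_subset.trans hτ
  left := by
    rw [Finset.mem_insert, Finset.mem_sdiff]
    exact (Finset.mem_insert.1 h₁).imp_right fun h => ⟨h, fun h' => (hs _ h').1.false⟩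
  right := by
    rw [Finset.mem_insert, Finset.mem_sdiff]
    exact (Finset.mem_insert.1 h₃).imp_right fun h => ⟨h, fun h' => (hs _ h').2.false⟩
  lt := hlt
  gap x hx hx₁ := by
    rw [Finset.mem_sdiff] at hx
    exact not_lt.1 fun hx₃ => hx.2 (hgap x hx.1 hx₁ hx₃)

theorem IsPenalizedLSE.chainCost_le {L q : ℝ} {Y : Fin n → ℝ} {τ : Finset ℕ}
    (hmin : IsPenalizedLSE L q Y τ) {t₁ t₃ : ℕ} {l₀ l : List ℕ} (h₁ : t₁ ∈ insert 1 τ)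
    (h₃ : t₃ ∈ insert (n + 1) τ) (hl₀ : (t₁ :: (l₀ ++ [t₃])).IsChain (· < ·))
    (hl₀τ : ∀ x ∈ l₀, x ∈ τ) (hgap : ∀ x ∈ τ, t₁ < x → x < t₃ → x ∈ l₀)
    (hl : (t₁ :: (l ++ [t₃])).IsChain (· < ·)) :
    chainCost L q Y t₁ l₀ t₃ ≤ chainCost L q Y t₁ l t₃ := by
  have hlt := lt_of_isChain hl₀
  have hc : Consec n (τ \ l₀.toFinset) t₁ t₃ :=
    .sdiff _ hmin.1 h₁ h₃ hlt.1 (by simpa only [List.mem_toFinset] using hlt.2)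
      (by simpa only [List.mem_toFinset] using hgap)
  have hunion : l₀.toFinset ∪ τ \ l₀.toFinset = τ :=
    Finset.union_sdiff_of_subset fun x hx => hl₀τ x (List.mem_toFinset.1 hx)
  have hcrit₀ := (crit_union_list L q Y l₀ hc hl₀).2
  obtain ⟨hsub, hcrit⟩ := crit_union_list L q Y l hc hl
  rw [hunion] at hcrit₀
  linarith [hmin.2 _ hsub]

end ChainCost

/-! ### Time reversal -/

section Reflection

variable {n : ℕ} {τ : Finset ℕ} {u w : ℕ}

/-- The change-point vector of the time-reversed signal `x ∘ Fin.rev`: the segment `[a, b)` of the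
signal becomes the segment `[n + 2 - b, n + 2 - a)`. -/
def reflect (n : ℕ) (τ : Finset ℕ) : Finset ℕ := τ.image (n + 2 - ·)

theorem reflect_subset (hτ : τ ⊆ Finset.Icc 2 n) : reflect n τ ⊆ Finset.Icc 2 n := fun t ht => by
  obtain ⟨s, hs, rfl⟩ := Finset.mem_image.1 ht
  have := Finset.mem_Icc.1 (hτ hs)
  exact Finset.mem_Icc.2 (by omega)

theorem reflect_reflect (hτ : τ ⊆ Finset.Icc 2 n) : reflect n (reflect n τ) = τ := by
  unfold reflect
  rw [Finset.image_image]
  refine (Finset.image_congr fun t ht => ?_).trans Finset.image_id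
  have := Finset.mem_Icc.1 (hτ ht)
  dsimp only [Function.comp_apply, id]
  omega

theorem segSum_rev (x : Fin n → ℝ) (hu : u ≤ n + 2) (hw : w ≤ n + 2) :
    segSum (x ∘ Fin.rev) (n + 2 - w) (n + 2 - u) = segSum x u w := by
  refine Finset.sum_equiv Fin.revPerm (fun i => ?_) fun i _ => rfl
  simp only [Finset.mem_filter, Finset.mem_univ, true_and, Fin.revPerm_apply, Fin.val_rev]
  omega

theorem cast_sub_cast_reflect (hu : u ≤ n + 2) (hw : w ≤ n + 2) :
    ((n + 2 - u : ℕ) : ℝ) - (n + 2 - w : ℕ) = (w : ℝ) - u := by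
  rw [Nat.cast_sub hu, Nat.cast_sub hw]
  ring

theorem cusum_rev (x : Fin n → ℝ) {a s b : ℕ} (ha : a ≤ n + 2) (hs : s ≤ n + 2)
    (hb : b ≤ n + 2) :
    cusum (x ∘ Fin.rev) (n + 2 - b) (n + 2 - s) (n + 2 - a) = -cusum x a s b := by
  unfold cusum
  rw [segSum_rev x ha hs, segSum_rev x hs hb, cast_sub_cast_reflect ha hs,
    cast_sub_cast_reflect hs hb, cast_sub_cast_reflect ha hb, mul_comm ((b : ℝ) - s)]
  ring

theorem segCost_rev (L q : ℝ) (x : Fin n → ℝ) (hu : u ≤ n + 2) (hw : w ≤ n + 2) :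
    segCost L q (x ∘ Fin.rev) (n + 2 - w) (n + 2 - u) = segCost L q x u w := by
  unfold segCost
  rw [segSum_rev x hu hw, cast_sub_cast_reflect hu hw]

theorem ConstOn.reflect {x : Fin n → ℝ} {r : ℝ} (h : ConstOn x r u w) :
    ConstOn (x ∘ Fin.rev) r (n + 2 - w) (n + 2 - u) := fun i hi hi' =>
  h i.rev (by rw [Fin.val_rev]; omega) (by rw [Fin.val_rev]; omega)

theorem Consec.reflect (h : Consec n τ u w) :
    Consec n (reflect n τ) (n + 2 - w) (n + 2 - u) where
  subset := reflect_subset h.subset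
  left := (Finset.mem_insert.1 h.right).elim (fun hw => by simp [hw])
    fun hw => Finset.mem_insert_of_mem (Finset.mem_image_of_mem _ hw)
  right := (Finset.mem_insert.1 h.left).elim (fun hu => by simp [hu])
    fun hu => Finset.mem_insert_of_mem (Finset.mem_image_of_mem _ hu)
  lt := by
    have := h.lt
    have := h.le_succ
    omega
  gap x hx hwx := by
    obtain ⟨t, ht, rfl⟩ := Finset.mem_image.1 hx
    have hut : ¬u < t := fun hut => by
      have := h.gap t ht hut
      omega
    omega

theorem crit_reflect (L q : ℝ) (x : Fin n → ℝ) (hn : 0 < n) (hτ : τ ⊆ Finset.Icc 2 n) :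
    crit L q (x ∘ Fin.rev) (reflect n τ) = crit L q x τ := by
  have start_of_start : ∀ {σ : Finset ℕ}, σ ⊆ Finset.Icc 2 n → ∀ a ∈ insert 1 σ,
      Consec n (reflect n σ) (n + 2 - nextPoint n σ a) (n + 2 - a) := fun hσ a ha =>
    (Consec.of_nextPoint hn hσ ha).reflect
  have start_involutive : ∀ {σ : Finset ℕ}, σ ⊆ Finset.Icc 2 n → ∀ a ∈ insert 1 σ,
      n + 2 - nextPoint n (reflect n σ) (n + 2 - nextPoint n σ a) = a := fun hσ a ha => by
    have := (Consec.of_nextPoint hn hσ ha).lt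
    have := (Consec.of_nextPoint hn hσ ha).le_succ
    rw [(start_of_start hσ a ha).nextPoint_eq]
    omega
  rw [crit_eq_sum_segCost L q _ hn (reflect_subset hτ), crit_eq_sum_segCost L q _ hn hτ]
  congr 1
  · exact congrArg (· - L * q) (Equiv.sum_comp Fin.revPerm fun i => x i ^ 2)
  symm
  refine Finset.sum_nbij' (fun a => n + 2 - nextPoint n τ a)
    (fun a => n + 2 - nextPoint n (reflect n τ) a) (fun a ha => (start_of_start hτ a ha).left)
    (fun a ha => ?_) (start_involutive hτ) (fun a ha => ?_) fun a ha => ?_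
  · simpa only [reflect_reflect hτ] using (start_of_start (reflect_subset hτ) a ha).left
  · simpa only [reflect_reflect hτ] using start_involutive (reflect_subset hτ) a ha
  · have h := Consec.of_nextPoint hn hτ ha
    have := h.lt
    have := h.le_succ
    rw [(start_of_start hτ a ha).nextPoint_eq, segCost_rev L q x (by omega) (by omega)]

theorem IsPenalizedLSE.reflect {L q : ℝ} {Y : Fin n → ℝ} (hn : 0 < n)
    (hmin : IsPenalizedLSE L q Y τ) : IsPenalizedLSE L q (Y ∘ Fin.rev) (reflect n τ) := by
  refine ⟨reflect_subset hmin.1, fun τ' hτ' => ?_⟩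
  rw [crit_reflect L q Y hn hmin.1, ← reflect_reflect hτ',
    crit_reflect L q Y hn (reflect_subset hτ')]
  exact hmin.2 _ (reflect_subset hτ')

end Reflection

/-! ### Thresholds as functions of the lengths -/

section Thresholds

variable {n q x y z : ℝ}

theorem thresholdSq_comm : thresholdSq n q x y = thresholdSq n q y x := by
  unfold thresholdSq
  rw [add_comm x y, mul_comm x y]

theorem thresholdSq_eq_segPen_add (hn : 0 < n) (hx : 0 < x) (hy : 0 < y) (hz : 0 < z) :
    thresholdSq n q x y = segPen n q z + 2 * Real.log (z / x + z / y) := by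
  have hprod : n * (x + y) / (x * y) = n / z * (z / x + z / y) := by
    field_simp
    ring
  unfold thresholdSq segPen
  rw [hprod, Real.log_mul (by positivity) (by positivity)]
  ring

theorem le_segPen (hz : 0 < z) (hzn : z ≤ n) : q ≤ segPen n q z := by
  have := Real.log_nonneg ((one_le_div hz).2 hzn)
  unfold segPen
  linarith

theorem segPen_le_thresholdSq (hn : 0 < n) (hx : 0 < x) (hz : 0 < z) :
    segPen n q z ≤ thresholdSq n q x z := by
  rw [thresholdSq_eq_segPen_add hn hx hz hz, div_self hz.ne']
  have hlog : 0 ≤ Real.log (z / x + 1) :=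
    Real.log_nonneg (le_add_of_nonneg_left (div_pos hz hx).le)
  linarith

theorem thresholdSq_anti {x' y' : ℝ} (hn : 0 < n) (hx : 0 < x) (hy : 0 < y) (hxx' : x ≤ x')
    (hyy' : y ≤ y') : thresholdSq n q x' y' ≤ thresholdSq n q x y := by
  have hx' := hx.trans_le hxx'
  have hy' := hy.trans_le hyy'
  rw [thresholdSq_eq_segPen_add hn hx' hy' one_pos, thresholdSq_eq_segPen_add hn hx hy one_pos]
  have hlog : Real.log (1 / x' + 1 / y') ≤ Real.log (1 / x + 1 / y) :=
    Real.log_le_log (by positivity)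
      (add_le_add (one_div_le_one_div_of_le hx hxx') (one_div_le_one_div_of_le hy hyy'))
  linarith

theorem thresholdSq_le_segPen_add (hn : 0 < n) (hx : 0 < x) (hy : 0 < y) (hz : 0 < z) {r : ℝ}
    (hr : z / x + z / y ≤ r) : thresholdSq n q x y ≤ segPen n q z + 2 * r := by
  rw [thresholdSq_eq_segPen_add hn hx hy hz]
  have hlog := Real.log_le_sub_one_of_pos (show 0 < z / x + z / y by positivity)
  linarith

theorem thresholdSq_le_segPen_add_of_le (hn : 0 < n) (hx : 0 < x) (hz : 0 < z) {r : ℝ}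
    (hzx : z ≤ r * x) : thresholdSq n q x z ≤ segPen n q z + 2 * (r + 1) :=
  thresholdSq_le_segPen_add hn hx hz hz
    (add_le_add ((div_le_iff₀ hx).2 hzx) (div_self hz.ne').le)

theorem mul_div_add_mono {x y x' y' : ℝ} (hx : 0 < x) (hy : 0 < y) (hxx' : x ≤ x')
    (hyy' : y ≤ y') : x * y / (x + y) ≤ x' * y' / (x' + y') := by
  have hx' := hx.trans_le hxx'
  have hy' := hy.trans_le hyy'
  have hinv {x y : ℝ} (hx : 0 < x) (hy : 0 < y) : x * y / (x + y) = (x⁻¹ + y⁻¹)⁻¹ := by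
    field_simp
    ring
  rw [hinv hx hy, hinv hx' hy']
  gcongr

theorem thresholdSq_mul_mul {c : ℝ} (hn : 0 < n) (hx : 0 < x) (hy : 0 < y) (hc : 0 < c) :
    thresholdSq n q (c * x) (c * y) = thresholdSq n q x y - 2 * Real.log c := by
  have hdiv : n * (c * x + c * y) / (c * x * (c * y)) = n * (x + y) / (x * y) / c := by
    field_simp
  unfold thresholdSq
  rw [hdiv, Real.log_div (by positivity) hc.ne']
  ring

end Thresholds

/-! ### Comparing CUSUM statistics of overlapping triads -/

/-- The weight `α` such that the CUSUM statistic at a point `a`, with a segment of length `x + y` on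
its left and one of length `z` on its right, is `√(1 + α) ν + √α e`, where `ν` is the statistic at
`a` with the first part of the left segment, of length `x`, cut off, and `e` is the statistic at the
point that cuts it off. -/
def overlapWeight (x y z : ℝ) : ℝ := z * x / (y * (x + y + z))

section OverlapWeight

variable {x y z : ℝ}

theorem overlapWeight_nonneg (hx : 0 ≤ x) (hy : 0 ≤ y) (hz : 0 ≤ z) :
    0 ≤ overlapWeight x y z := by
  unfold overlapWeight
  positivity

theorem overlapWeight_le_of_le (hx : 0 < x) (hy : 0 < y) (hz : 0 < z) {t : ℝ} (hzy : z ≤ t * y) :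
    overlapWeight x y z ≤ t := by
  unfold overlapWeight
  rw [div_le_iff₀ (by positivity), ← mul_assoc]
  exact mul_le_mul hzy (by linarith) hx.le (hz.le.trans hzy)

theorem overlapWeight_le_of_le_of_le (hx : 0 < x) (hy : 0 < y) (hz : 0 < z) {t : ℝ}
    (hxz : x ≤ z) (hzy : z ≤ t * y) : overlapWeight x y z ≤ t ^ 2 / (2 * t + 1) := by
  have ht : 0 < t := pos_of_mul_pos_left (hz.trans_le hzy) hy.le
  have hmono : x * (2 * z + y) ≤ z * (x + y + z) := by nlinarith
  have hsq : z * (x * (2 * t + 1)) ≤ t ^ 2 * (y * (x + y + z)) := by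
    have h₁ : 0 ≤ (t * y - z) * (x * (2 * t + 1)) :=
      mul_nonneg (sub_nonneg.2 hzy) (by positivity)
    have h₂ : 0 ≤ t * y * (t * (z - x) + (t * y - z) + (z - x)) :=
      mul_nonneg (by positivity) (by nlinarith)
    nlinarith
  unfold overlapWeight
  rw [div_le_div_iff₀ (by positivity) (by positivity), mul_assoc]
  exact hsq

/-- The algebra behind `cusum_left`, with `M₁`, `M₂`, `M₃` the means over three consecutive
segments of lengths `x`, `y`, `z`. -/
theorem merge_mean_diff_eq {M₁ M₂ M₃ : ℝ} (hx : 0 < x) (hy : 0 < y) (hz : 0 < z) :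
    (M₃ - (x * M₁ + y * M₂) / (x + y)) * √((x + y) * z / (x + y + z)) =
      √(1 + overlapWeight x y z) * ((M₃ - M₂) * √(y * z / (y + z))) +
      √(overlapWeight x y z) * ((M₂ - M₁) * √(x * y / (x + y))) := by
  have hright : √(1 + overlapWeight x y z) * √(y * z / (y + z)) =
      √((x + y) * z / (x + y + z)) := by
    rw [← Real.sqrt_mul (add_nonneg zero_le_one (overlapWeight_nonneg hx.le hy.le hz.le))]
    congr 1
    unfold overlapWeight
    field_simp
    ring
  have hleft : √(overlapWeight x y z) * √(x * y / (x + y)) =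
      x / (x + y) * √((x + y) * z / (x + y + z)) := by
    rw [← Real.sqrt_mul (overlapWeight_nonneg hx.le hy.le hz.le),
      ← Real.sqrt_sq (show 0 ≤ x / (x + y) by positivity), ← Real.sqrt_mul (by positivity)]
    congr 1
    unfold overlapWeight
    field_simp
  have hmean : (x * M₁ + y * M₂) / (x + y) = M₂ - x / (x + y) * (M₂ - M₁) := by
    field_simp
    ring
  rw [hmean]
  linear_combination -(M₃ - M₂) * hright - (M₂ - M₁) * hleft

theorem cusum_left {n : ℕ} (Y : Fin n → ℝ) {t₁ v a m : ℕ} (h₁ : t₁ < v) (h₂ : v < a)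
    (h₃ : a < m) :
    cusum Y t₁ a m =
      √(1 + overlapWeight ((v : ℝ) - t₁) ((a : ℝ) - v) ((m : ℝ) - a)) * cusum Y v a m +
      √(overlapWeight ((v : ℝ) - t₁) ((a : ℝ) - v) ((m : ℝ) - a)) * cusum Y t₁ v a := by
  have hx : (0 : ℝ) < (v : ℝ) - t₁ := sub_pos.2 (Nat.cast_lt.2 h₁)
  have hy : (0 : ℝ) < (a : ℝ) - v := sub_pos.2 (Nat.cast_lt.2 h₂)
  have hz : (0 : ℝ) < (m : ℝ) - a := sub_pos.2 (Nat.cast_lt.2 h₃)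
  have hxyz : (m : ℝ) - t₁ = ((v : ℝ) - t₁) + ((a : ℝ) - v) + ((m : ℝ) - a) := by ring
  have hxy : (a : ℝ) - t₁ = ((v : ℝ) - t₁) + ((a : ℝ) - v) := by ring
  have hyz : (m : ℝ) - v = ((a : ℝ) - v) + ((m : ℝ) - a) := by ring
  unfold cusum
  rw [← segSum_add_segSum Y h₁.le h₂.le, hxyz, hxy, hyz, ← merge_mean_diff_eq hx hy hz,
    mul_div_cancel₀ _ hx.ne', mul_div_cancel₀ _ hy.ne']

end OverlapWeight

/-! ### The gain from removing or moving one point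

A segment is cut into parts of lengths `x` and `y`, and is followed by a segment of length `z`. The
statistics `ν`, `e` and `f` are those of `overlapWeight`. Removing the point between `y` and `z`
lowers the criterion by `L * thresholdSq n q (x + y) z - f ^ 2`, and moving it to the point between
`x` and `y` by `L * thresholdSq n q y z - ν ^ 2 - (L * thresholdSq n q x y - e ^ 2)`. -/

section Gain

variable {n q L x y z ν e f : ℝ}

theorem sq_sqrt_add_sqrt_le {α : ℝ} (hα : 0 ≤ α) (hα2 : α ≤ 2) :
    (√(1 + α) * ν + √α * e) ^ 2 ≤ 1.01 * (α * e ^ 2) + 303 * ν ^ 2 := by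
  have hA : (√(1 + α) * ν) ^ 2 ≤ 3 * ν ^ 2 := by
    rw [mul_pow, Real.sq_sqrt (by linarith)]
    exact mul_le_mul_of_nonneg_right (by linarith) (sq_nonneg ν)
  have hB : (√α * e) ^ 2 = α * e ^ 2 := by rw [mul_pow, Real.sq_sqrt hα]
  nlinarith [sq_nonneg (10 * (√(1 + α) * ν) - √α * e / 10)]

theorem le_removal_gain (hn : 0 < n) (hL : 0 < L) (hq : 0 ≤ q) (hx : 0 < x) (hy : 0 < y)
    (hz : 0 < z) (hzn : z ≤ n) (hyz : z ≤ 2 * y) (hν : ν ^ 2 ≤ 1 / 10 ^ 5 * (L * segPen n q z))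
    (hf : f = √(1 + overlapWeight x y z) * ν + √(overlapWeight x y z) * e) :
    0.995 * (L * segPen n q z) - 1.01 * (overlapWeight x y z * e ^ 2) ≤
      L * thresholdSq n q (x + y) z - f ^ 2 := by
  have hW : 0 ≤ L * segPen n q z := mul_nonneg hL.le (hq.trans (le_segPen hz hzn))
  have hf2 := sq_sqrt_add_sqrt_le (ν := ν) (e := e) (overlapWeight_nonneg hx.le hy.le hz.le)
    (overlapWeight_le_of_le hx hy hz hyz)
  have hpen := mul_le_mul_of_nonneg_left
    (segPen_le_thresholdSq (q := q) hn (add_pos hx hy) hz) hL.le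
  rw [hf]
  linarith

theorem le_moving_gain (hn : 0 < n) (hL : 0 < L) (hy : 0 < y) (hz : 0 < z) (hzx : z ≤ x) :
    e ^ 2 - ν ^ 2 ≤ L * thresholdSq n q y z - ν ^ 2 - (L * thresholdSq n q x y - e ^ 2) := by
  have hanti := mul_le_mul_of_nonneg_left (thresholdSq_anti (q := q) hn hz hy hzx le_rfl) hL.le
  rw [thresholdSq_comm (x := y)]
  linarith

theorem overlapWeight_mul_sq_le (hn : 0 < n) (hq : 10 ^ 8 ≤ q) (hL : 0 < L) (hx : 0 < x)
    (hy : 0 < y) (hz : 0 < z) (hzn : z ≤ n) (he : e ^ 2 ≤ L * thresholdSq n q x y) (hxz : x ≤ z)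
    (hyz : z ≤ 2 * y) :
    overlapWeight x y z * e ^ 2 ≤ (overlapWeight x y z + 0.01) * (L * segPen n q z) := by
  have hα := overlapWeight_nonneg hx.le hy.le hz.le
  have hsum : z / x + z / y ≤ 3 * (z / x) := by
    have h₁ : z / y ≤ 2 := (div_le_iff₀ hy).2 hyz
    have h₂ : 1 ≤ z / x := (one_le_div hx).2 hxz
    linarith
  have hT := thresholdSq_le_segPen_add (q := q) hn hx hy hz hsum
  have hαz : overlapWeight x y z * (z / x) ≤ 4 / 3 := by
    have : overlapWeight x y z * (z / x) = z ^ 2 / (y * (x + y + z)) := by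
      unfold overlapWeight
      field_simp
    rw [this, div_le_iff₀ (by positivity)]
    nlinarith [mul_pos hx hy, mul_pos hy hz]
  have hW : L * 10 ^ 8 ≤ L * segPen n q z :=
    mul_le_mul_of_nonneg_left (hq.trans (le_segPen hz hzn)) hL.le
  calc overlapWeight x y z * e ^ 2
      ≤ overlapWeight x y z * (L * (segPen n q z + 2 * (3 * (z / x)))) :=
        mul_le_mul_of_nonneg_left (he.trans (mul_le_mul_of_nonneg_left hT hL.le)) hα
    _ = overlapWeight x y z * (L * segPen n q z) +
          6 * L * (overlapWeight x y z * (z / x)) := by ring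
    _ ≤ overlapWeight x y z * (L * segPen n q z) + 6 * L * (4 / 3) :=
        add_le_add_right (mul_le_mul_of_nonneg_left hαz (by linarith)) _
    _ ≤ (overlapWeight x y z + 0.01) * (L * segPen n q z) := by linarith

theorem le_removal_gain_of_le (hn : 0 < n) (hq : 10 ^ 8 ≤ q) (hL : 0 < L) (hx : 0 < x)
    (hy : 0 < y) (hz : 0 < z) (hzn : z ≤ n) (hν : ν ^ 2 ≤ 1 / 10 ^ 5 * (L * segPen n q z))
    (he : e ^ 2 ≤ L * thresholdSq n q x y)
    (hf : f = √(1 + overlapWeight x y z) * ν + √(overlapWeight x y z) * e) (hxz : x ≤ z) {t : ℝ}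
    (hzy : z ≤ t * y) (ht : t ≤ 2) :
    (0.97 - 1.01 * (t ^ 2 / (2 * t + 1))) * (L * segPen n q z) ≤
      L * thresholdSq n q (x + y) z - f ^ 2 := by
  have hyz : z ≤ 2 * y := hzy.trans (mul_le_mul_of_nonneg_right ht hy.le)
  have hgain := le_removal_gain hn hL (by linarith) hx hy hz hzn hyz hν hf
  have he' := overlapWeight_mul_sq_le hn hq hL hx hy hz hzn he hxz hyz
  have hW : 0 ≤ L * segPen n q z :=
    mul_nonneg hL.le (by linarith [le_segPen (q := q) hz hzn])
  have hα := mul_le_mul_of_nonneg_right (overlapWeight_le_of_le_of_le hx hy hz hxz hzy) hW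
  linarith

theorem removal_gain_pos_or_moving_gain_pos (hn : 0 < n) (hq : 10 ^ 8 ≤ q) (hL : 0 < L)
    (hx : 0 < x) (hy : 0 < y) (hz : 0 < z) (hzn : z ≤ n)
    (hν : ν ^ 2 ≤ 1 / 10 ^ 5 * (L * segPen n q z)) (he : e ^ 2 ≤ L * thresholdSq n q x y)
    (hf : f = √(1 + overlapWeight x y z) * ν + √(overlapWeight x y z) * e) (hyz : z ≤ 2 * y) :
    0 < L * thresholdSq n q (x + y) z - f ^ 2 ∨
    0 < L * thresholdSq n q y z - ν ^ 2 - (L * thresholdSq n q x y - e ^ 2) := by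
  have hW : 0 < L * segPen n q z := mul_pos hL (by linarith [le_segPen (q := q) hz hzn])
  rcases le_total x z with hxz | hzx
  · left
    have hgain := le_removal_gain_of_le hn hq hL hx hy hz hzn hν he hf hxz hyz le_rfl
    norm_num at hgain
    linarith
  · by_contra! hcon
    have hremove := le_removal_gain hn hL (by linarith) hx hy hz hzn hyz hν hf
    have hmove := le_moving_gain (q := q) (ν := ν) (e := e) hn hL hy hz hzx
    have hα := mul_le_mul_of_nonneg_right (overlapWeight_le_of_le hx hy hz hyz) (sq_nonneg e)
    linarith [hcon.1, hcon.2]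

theorem le_two_mul_of_half_lt_overlapWeight (hx : 0 < x) (hy : 0 < y) (hz : 0 < z)
    (hα : 1 / 2 < overlapWeight x y z) : y ≤ 2 * z := by
  unfold overlapWeight at hα
  rw [lt_div_iff₀ (by positivity)] at hα
  by_contra! hlt
  nlinarith [mul_pos hx hy, mul_pos hy hz, mul_pos hx hz]

theorem removal_gain_ge_or_moving_gain_ge_or_add_ge (hn : 0 < n) (hq : 10 ^ 8 ≤ q) (hL : 0 < L)
    (hx : 0 < x) (hy : 0 < y) (hz : 0 < z) (hzn : z ≤ n)
    (hν : ν ^ 2 ≤ 1 / 10 ^ 5 * (L * segPen n q z)) (he : e ^ 2 ≤ L * thresholdSq n q x y)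
    (hf : f = √(1 + overlapWeight x y z) * ν + √(overlapWeight x y z) * e) (hzy : z ≤ y) :
    0.6 * (L * segPen n q z) ≤ L * thresholdSq n q (x + y) z - f ^ 2 ∨
    0.6 * (L * segPen n q z) ≤
      L * thresholdSq n q y z - ν ^ 2 - (L * thresholdSq n q x y - e ^ 2) ∨
    (y ≤ 2 * z ∧ 0.96 * (L * segPen n q z) ≤
      (L * thresholdSq n q (x + y) z - f ^ 2) +
        (L * thresholdSq n q y z - ν ^ 2 - (L * thresholdSq n q x y - e ^ 2))) := by
  have hW : L * 10 ^ 8 ≤ L * segPen n q z :=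
    mul_le_mul_of_nonneg_left (hq.trans (le_segPen hz hzn)) hL.le
  rcases le_total x z with hxz | hzx
  · left
    have hgain := le_removal_gain_of_le hn hq hL hx hy hz hzn hν he hf hxz
      (hzy.trans_eq (one_mul y).symm) one_le_two
    norm_num at hgain ⊢
    linarith
  have hremove := le_removal_gain hn hL (by linarith) hx hy hz hzn (by linarith) hν hf
  have hmove := le_moving_gain (q := q) (ν := ν) (e := e) hn hL hy hz hzx
  rcases le_or_gt (overlapWeight x y z) (1 / 2) with hα | hα
  · have hαe := mul_le_mul_of_nonneg_right hα (sq_nonneg e)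
    by_contra! hcon
    linarith [hcon.1, hcon.2.1]
  · refine .inr (.inr ⟨le_two_mul_of_half_lt_overlapWeight hx hy hz hα, ?_⟩)
    have hαe := mul_le_mul_of_nonneg_right
      (overlapWeight_le_of_le hx hy hz (hzy.trans_eq (one_mul y).symm)) (sq_nonneg e)
    have hT := mul_le_mul_of_nonneg_left (thresholdSq_le_segPen_add (q := q) hn hx hy hz
      (add_le_add ((div_le_one hx).2 hzx) ((div_le_one hy).2 hzy))) hL.le
    linarith

end Gain

/-! ### Controlled noise -/

section NoiseBound

variable {n : ℕ} {q : ℝ} {θ ε : Fin n → ℝ} {t₁ t₂ t₃ : ℕ}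

/-- The realization `ε` of the noise lies in the event `noiseEvent`. -/
def NoiseBound (ε : Fin n → ℝ) (q : ℝ) : Prop :=
  ∀ t₁ t₂ t₃ : ℕ, 1 ≤ t₁ → t₁ < t₂ → t₂ < t₃ → t₃ ≤ n + 1 →
    |cusum ε t₁ t₂ t₃| ≤ 2 * threshold n q t₁ t₂ t₃

theorem threshold_eq (n : ℕ) (q : ℝ) (t₁ t₂ t₃ : ℕ) :
    threshold n q t₁ t₂ t₃ = √(thresholdSq n q ((t₂ : ℝ) - t₁) ((t₃ : ℝ) - t₂)) := by
  unfold threshold thresholdSq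
  rw [mul_comm ((t₃ : ℝ) - t₂), sub_add_sub_cancel']

theorem NoiseBound.reflect (hε : NoiseBound ε q) : NoiseBound (ε ∘ Fin.rev) q := by
  intro t₁ t₂ t₃ h₁ h₁₂ h₂₃ h₃
  have hcusum := cusum_rev ε (a := n + 2 - t₃) (s := n + 2 - t₂) (b := n + 2 - t₁) (by omega)
    (by omega) (by omega)
  have h := hε (n + 2 - t₃) (n + 2 - t₂) (n + 2 - t₁) (by omega) (by omega) (by omega) (by omega)
  rw [Nat.sub_sub_self (by omega), Nat.sub_sub_self (by omega), Nat.sub_sub_self (by omega)]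
    at hcusum
  rw [threshold_eq, cast_sub_cast_reflect (by omega) (by omega),
    cast_sub_cast_reflect (by omega) (by omega), thresholdSq_comm, ← threshold_eq] at h
  rwa [hcusum, abs_neg]

theorem cast_sub_le {a b : ℕ} (ha : 1 ≤ a) (hb : b ≤ n + 1) : (b : ℝ) - a ≤ n := by
  have : (b : ℝ) ≤ n + a := by exact_mod_cast (by omega : b ≤ n + a)
  linarith

theorem le_thresholdSq (q : ℝ) (h₀ : 1 ≤ t₁) (h₁ : t₁ < t₂) (h₂ : t₂ < t₃) (h₃ : t₃ ≤ n + 1) :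
    q ≤ thresholdSq n q ((t₂ : ℝ) - t₁) ((t₃ : ℝ) - t₂) := by
  have hn : (0 : ℝ) < n := Nat.cast_pos.2 (by omega)
  have hy : (0 : ℝ) < (t₃ : ℝ) - t₂ := sub_pos.2 (Nat.cast_lt.2 h₂)
  exact (le_segPen hy (cast_sub_le (by omega) h₃)).trans
    (segPen_le_thresholdSq hn (sub_pos.2 (Nat.cast_lt.2 h₁)) hy)

theorem NoiseBound.sq_cusum_le (hε : NoiseBound ε q) (hq : 0 ≤ q) (h₀ : 1 ≤ t₁)
    (h₁ : t₁ < t₂) (h₂ : t₂ < t₃) (h₃ : t₃ ≤ n + 1) :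
    cusum ε t₁ t₂ t₃ ^ 2 ≤ 4 * thresholdSq n q ((t₂ : ℝ) - t₁) ((t₃ : ℝ) - t₂) := by
  have h := pow_le_pow_left₀ (abs_nonneg _) (hε t₁ t₂ t₃ h₀ h₁ h₂ h₃) 2
  rw [sq_abs, threshold_eq, mul_pow, Real.sq_sqrt (hq.trans (le_thresholdSq q h₀ h₁ h₂ h₃))] at h
  linarith

theorem NoiseBound.sq_cusum_le_of_constOn (hε : NoiseBound ε q) (hq : 0 ≤ q) {r : ℝ}
    (h₀ : 1 ≤ t₁) (h₁ : t₁ < t₂) (h₂ : t₂ < t₃) (h₃ : t₃ ≤ n + 1) (hθ : ConstOn θ r t₁ t₃) :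
    cusum (fun i => θ i + ε i) t₁ t₂ t₃ ^ 2 ≤
      4 * thresholdSq n q ((t₂ : ℝ) - t₁) ((t₃ : ℝ) - t₂) := by
  rw [cusum_add, cusum_eq_zero_of_constOn h₀ h₁ h₂ h₃ hθ, zero_add]
  exact hε.sq_cusum_le hq h₀ h₁ h₂ h₃

theorem sq_add_le (x y : ℝ) : (x + y) ^ 2 ≤ 1.1 * x ^ 2 + 11 * y ^ 2 := by
  nlinarith [sq_nonneg (x - 10 * y)]

theorem NoiseBound.sq_cusum_signal_le (hε : NoiseBound ε q) (hq : 0 ≤ q) (h₀ : 1 ≤ t₁)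
    (h₁ : t₁ < t₂) (h₂ : t₂ < t₃) (h₃ : t₃ ≤ n + 1) :
    cusum θ t₁ t₂ t₃ ^ 2 ≤ 1.1 * cusum (fun i => θ i + ε i) t₁ t₂ t₃ ^ 2 +
      44 * thresholdSq n q ((t₂ : ℝ) - t₁) ((t₃ : ℝ) - t₂) := by
  have h := sq_add_le (cusum (fun i => θ i + ε i) t₁ t₂ t₃) (-cusum ε t₁ t₂ t₃)
  rw [cusum_add, add_neg_cancel_right, neg_sq] at h
  rw [cusum_add]
  linarith [hε.sq_cusum_le hq h₀ h₁ h₂ h₃]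

theorem NoiseBound.sq_cusum_observation_le (hε : NoiseBound ε q) (hq : 0 ≤ q) (h₀ : 1 ≤ t₁)
    (h₁ : t₁ < t₂) (h₂ : t₂ < t₃) (h₃ : t₃ ≤ n + 1) :
    cusum (fun i => θ i + ε i) t₁ t₂ t₃ ^ 2 ≤ 1.1 * cusum θ t₁ t₂ t₃ ^ 2 +
      44 * thresholdSq n q ((t₂ : ℝ) - t₁) ((t₃ : ℝ) - t₂) := by
  have h := sq_add_le (cusum θ t₁ t₂ t₃) (cusum ε t₁ t₂ t₃)
  rw [cusum_add]
  linarith [hε.sq_cusum_le hq h₀ h₁ h₂ h₃]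

end NoiseBound

/-! ### The signal around a jump -/

section Jump

variable {n : ℕ} {q L x y : ℝ} {θ ε : Fin n → ℝ} {r₁ r₂ : ℝ} {u a s b w : ℕ}

theorem sq_cusum_eq_of_jump (ha : 1 ≤ a) (has : a < s) (hsb : s < b) (hb : b ≤ n + 1)
    (h₁ : ConstOn θ r₁ a s) (h₂ : ConstOn θ r₂ s b) :
    cusum θ a s b ^ 2 =
      (r₂ - r₁) ^ 2 * (((s : ℝ) - a) * ((b : ℝ) - s) / ((s : ℝ) - a + ((b : ℝ) - s))) := by
  have hx : (0 : ℝ) < (s : ℝ) - a := sub_pos.2 (Nat.cast_lt.2 has)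
  have hy : (0 : ℝ) < (b : ℝ) - s := sub_pos.2 (Nat.cast_lt.2 hsb)
  rw [cusum_eq_of_jump ha has hsb hb h₁ h₂, mul_pow, ← sub_add_sub_cancel' (s : ℝ) a b,
    Real.sq_sqrt (by positivity)]

theorem sq_cusum_le_of_jump_right (hu : 1 ≤ u) (hua : u < a) (has : a < s) (hsb : s < b)
    (hb : b ≤ n + 1) (h₁ : ConstOn θ r₁ u s) (h₂ : ConstOn θ r₂ s b) :
    cusum θ u a b ^ 2 ≤ ((b : ℝ) - s) / ((s : ℝ) - a) * cusum θ a s b ^ 2 := by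
  have hx : (0 : ℝ) < (s : ℝ) - a := sub_pos.2 (Nat.cast_lt.2 has)
  have hy : (0 : ℝ) < (b : ℝ) - s := sub_pos.2 (Nat.cast_lt.2 hsb)
  have hz : (0 : ℝ) < (a : ℝ) - u := sub_pos.2 (Nat.cast_lt.2 hua)
  have hxyz : (b : ℝ) - u = (s : ℝ) - a + ((b : ℝ) - s) + ((a : ℝ) - u) := by ring
  rw [sq_cusum_eq_of_jump (by omega) has hsb hb (h₁.mono hua.le le_rfl) h₂]
  unfold cusum
  rw [← segSum_add_segSum θ has.le hsb.le,
    segSum_eq_of_constOn (h₁.mono hua.le le_rfl) (by omega) has.le (by omega),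
    segSum_eq_of_constOn h₂ (by omega) hsb.le hb,
    segSum_eq_of_constOn (h₁.mono le_rfl has.le) hu hua.le (by omega), hxyz,
    ← sub_add_sub_cancel' (s : ℝ) a b]
  generalize (s : ℝ) - a = x at hx
  generalize (b : ℝ) - s = y at hy
  generalize (a : ℝ) - u = z at hz
  have hmean : (x * r₁ + y * r₂) / (x + y) - r₁ = (r₂ - r₁) * (y / (x + y)) := by
    field_simp
    ring
  calc (((x * r₁ + y * r₂) / (x + y) - z * r₁ / z) * √(z * (x + y) / (x + y + z))) ^ 2
      = y / x * ((r₂ - r₁) ^ 2 * (x * y / (x + y))) * (z / (x + y + z)) := by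
        rw [mul_pow, Real.sq_sqrt (by positivity), mul_div_cancel_left₀ _ hz.ne', hmean]
        field_simp
    _ ≤ y / x * ((r₂ - r₁) ^ 2 * (x * y / (x + y))) :=
        mul_le_of_le_one_right (by positivity) ((div_le_one (by positivity)).2 (by linarith))

theorem mul_thresholdSq_le_segPen_add (hn : 0 < n) (hx : 0 < x) (hy : 0 < y) :
    x / y * thresholdSq n q x y ≤ x / y * segPen n q (x + y) + 2 * (1 + x / y) ^ 2 := by
  have h := mul_le_mul_of_nonneg_left
    (thresholdSq_le_segPen_add (q := q) (Nat.cast_pos.2 hn) hx hy (add_pos hx hy) le_rfl)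
    (div_pos hx hy).le
  have hsq : x / y * (2 * ((x + y) / x + (x + y) / y)) = 2 * (1 + x / y) ^ 2 := by
    field_simp
    ring
  rwa [mul_add, hsq] at h

theorem NoiseBound.sq_cusum_signal_le_of_near_right (hε : NoiseBound ε q) (hq : 10 ^ 9 ≤ q)
    (hL : 10 ^ 8 ≤ L) (hu : 1 ≤ u) (hua : u < a) (has : a < s) (hsb : s < b) (hb : b ≤ n + 1)
    (hθ₁ : ConstOn θ r₁ u s) (hθ₂ : ConstOn θ r₂ s b) (hnear : 10 ^ 6 * (b - s) ≤ s - a)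
    (hins : 0 ≤ insertCost L q (fun i => θ i + ε i) a s b) :
    cusum θ u a b ^ 2 ≤ 3 / 10 ^ 6 * (L * segPen n q ((b : ℝ) - a)) := by
  have hx : (0 : ℝ) < (s : ℝ) - a := sub_pos.2 (Nat.cast_lt.2 has)
  have hy : (0 : ℝ) < (b : ℝ) - s := sub_pos.2 (Nat.cast_lt.2 hsb)
  have hratio : ((b : ℝ) - s) / ((s : ℝ) - a) ≤ 1 / 10 ^ 6 := by
    rw [div_le_div_iff₀ hx (by norm_num), ← Nat.cast_sub has.le, ← Nat.cast_sub hsb.le]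
    exact_mod_cast (by omega : (b - s) * 10 ^ 6 ≤ 1 * (s - a))
  have hW := le_segPen (n := n) (q := q) (z := (b : ℝ) - a) (by linarith)
    (cast_sub_le (by omega) hb)
  have hT := le_thresholdSq (n := n) q (by omega) has hsb hb
  have hθ := hε.sq_cusum_signal_le (θ := θ) (by linarith) (by omega) has hsb hb
  have hmul := mul_thresholdSq_le_segPen_add (q := q) (by omega : 0 < n) hy hx
  unfold insertCost at hins
  rw [thresholdSq_comm] at hins hT hθ
  rw [sub_add_sub_cancel] at hmul
  have hρ := div_pos hy hx
  refine (sq_cusum_le_of_jump_right hu hua has hsb hb hθ₁ hθ₂).trans ?_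
  generalize ((b : ℝ) - s) / ((s : ℝ) - a) = ρ at hratio hmul hρ
  generalize thresholdSq n q ((b : ℝ) - s) ((s : ℝ) - a) = T at *
  generalize segPen n q ((b : ℝ) - a) = W at *
  calc ρ * cusum θ a s b ^ 2 ≤ ρ * (2 * L * T) :=
        mul_le_mul_of_nonneg_left (by nlinarith) hρ.le
    _ = 2 * L * (ρ * T) := by ring
    _ ≤ 2 * L * (1 / 10 ^ 6 * W + 8) := by
        refine mul_le_mul_of_nonneg_left (hmul.trans (add_le_add ?_ ?_)) (by linarith)
        · exact mul_le_mul_of_nonneg_right hratio (by linarith)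
        · nlinarith
    _ ≤ 3 / 10 ^ 6 * (L * W) := by nlinarith

end Jump

/-! ### Removing and moving an entry of a minimizer -/

section Optimality

variable {n : ℕ} {q L : ℝ} {Y θ ε : Fin n → ℝ} {τ : Finset ℕ} {r : ℝ} {t₁ u a s b w t₃ : ℕ}

theorem Consec.mem (h₁ : Consec n τ t₁ a) (h₂ : Consec n τ a b) : a ∈ τ :=
  (Finset.mem_insert.1 h₁.right).resolve_left
    (h₂.lt.trans_le h₂.le_succ).ne

theorem insertCost_rev (L q : ℝ) (Y : Fin n → ℝ) (hu : u ≤ n + 2) (hs : s ≤ n + 2)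
    (hw : w ≤ n + 2) :
    insertCost L q (Y ∘ Fin.rev) (n + 2 - w) (n + 2 - s) (n + 2 - u) = insertCost L q Y u s w := by
  unfold insertCost
  rw [cusum_rev Y hu hs hw, neg_sq, cast_sub_cast_reflect hs hw, cast_sub_cast_reflect hu hs,
    thresholdSq_comm]

theorem IsPenalizedLSE.segCost_le_chainCost (hmin : IsPenalizedLSE L q Y τ)
    (h : Consec n τ t₁ t₃) {l : List ℕ} (hl : (t₁ :: (l ++ [t₃])).IsChain (· < ·)) :
    segCost L q Y t₁ t₃ ≤ chainCost L q Y t₁ l t₃ :=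
  hmin.chainCost_le (l₀ := []) h.left h.right (by simpa using h.lt) (by simp)
    (fun x hx hx₁ hx₃ => absurd (h.gap x hx hx₁) (not_le.2 hx₃)) hl

theorem IsPenalizedLSE.insertCost_nonneg (hmin : IsPenalizedLSE L q Y τ) (h : Consec n τ t₁ t₃)
    (h₁ : t₁ < s) (h₃ : s < t₃) : 0 ≤ insertCost L q Y t₁ s t₃ := by
  have hle := hmin.segCost_le_chainCost h (l := [s]) (by simp [h₁, h₃])
  simp only [chainCost, segCost_add_segCost L q Y h.n_pos h₁ h₃] at hle
  linarith

theorem IsPenalizedLSE.segCost_add_segCost_le (hmin : IsPenalizedLSE L q Y τ)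
    (h₁ : Consec n τ t₁ a) (h₂ : Consec n τ a b) {l : List ℕ}
    (hl : (t₁ :: (l ++ [b])).IsChain (· < ·)) :
    segCost L q Y t₁ a + segCost L q Y a b ≤ chainCost L q Y t₁ l b :=
  hmin.chainCost_le (l₀ := [a]) h₁.left h₂.right (by simp [h₁.lt, h₂.lt])
    (by simp [h₁.mem h₂]) (fun x hx hx₁ hx₃ => by
      rcases (h₁.gap x hx hx₁).eq_or_lt with heq | hlt
      · simp [heq]
      · exact absurd (h₂.gap x hx hlt) (not_le.2 hx₃)) hl

theorem IsPenalizedLSE.insertCost_nonpos (hmin : IsPenalizedLSE L q Y τ) (h₁ : Consec n τ t₁ a)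
    (h₂ : Consec n τ a b) : insertCost L q Y t₁ a b ≤ 0 := by
  have h := hmin.segCost_add_segCost_le h₁ h₂ (l := []) (by simp [h₁.lt.trans h₂.lt])
  simp only [chainCost, segCost_add_segCost L q Y h₁.n_pos h₁.lt h₂.lt] at h
  linarith

theorem IsPenalizedLSE.insertCost_le_insertCost (hmin : IsPenalizedLSE L q Y τ)
    (h₁ : Consec n τ t₁ a) (h₂ : Consec n τ a b) (hu : t₁ < u) (hua : u < a) :
    insertCost L q Y u a b ≤ insertCost L q Y t₁ u a := by
  have h := hmin.segCost_add_segCost_le h₁ h₂ (l := [u]) (by simp [hu, hua.trans h₂.lt])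
  simp only [chainCost] at h
  linarith [segCost_add_segCost L q Y h₁.n_pos hu hua, segCost_add_segCost L q Y h₁.n_pos hua h₂.lt]

theorem IsPenalizedLSE.lt_sq_cusum (hmin : IsPenalizedLSE L q Y τ) (hq : 10 ^ 8 ≤ q) (hL : 0 < L)
    (h₁ : Consec n τ t₁ a) (h₂ : Consec n τ a b) (hu : t₁ ≤ u) (hua : u < a)
    (hfar : t₁ < u → b + 2 * u ≤ 3 * a) :
    4 / 10 ^ 6 * (L * thresholdSq n q ((a : ℝ) - u) ((b : ℝ) - a)) < cusum Y u a b ^ 2 := by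
  have hn : (0 : ℝ) < n := Nat.cast_pos.2 h₁.n_pos
  rcases hu.eq_or_lt with rfl | hu
  · have hT := mul_pos hL (by linarith [le_thresholdSq q h₁.one_le h₁.lt h₂.lt h₂.le_succ] :
      0 < thresholdSq n q ((a : ℝ) - t₁) ((b : ℝ) - a))
    have h := hmin.insertCost_nonpos h₁ h₂
    unfold insertCost at h
    linarith
  have hx : (0 : ℝ) < (u : ℝ) - t₁ := sub_pos.2 (Nat.cast_lt.2 hu)
  have hy : (0 : ℝ) < (a : ℝ) - u := sub_pos.2 (Nat.cast_lt.2 hua)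
  have hz : (0 : ℝ) < (b : ℝ) - a := sub_pos.2 (Nat.cast_lt.2 h₂.lt)
  have hzn := cast_sub_le h₂.one_le h₂.le_succ
  have hyz : (b : ℝ) - a ≤ 2 * ((a : ℝ) - u) := by
    have : (b : ℝ) + 2 * u ≤ 3 * a := by exact_mod_cast hfar hu
    linarith
  by_contra! hsmall
  have hseg := le_segPen (q := q) hz hzn
  have hT : L * thresholdSq n q ((a : ℝ) - u) ((b : ℝ) - a) ≤
      L * (1.1 * segPen n q ((b : ℝ) - a)) :=
    mul_le_mul_of_nonneg_left
      ((thresholdSq_le_segPen_add_of_le hn hy hz hyz).trans (by linarith)) hL.le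
  have hgain := removal_gain_pos_or_moving_gain_pos hn hq hL hx hy hz hzn
    (ν := cusum Y u a b) (by nlinarith) (sub_nonneg.1 (hmin.insertCost_nonneg h₁ hu hua))
    (cusum_left Y hu hua h₂.lt) hyz
  rw [sub_add_sub_cancel'] at hgain
  rcases hgain with hremove | hmove
  · exact hremove.not_ge (hmin.insertCost_nonpos h₁ h₂)
  · exact hmove.not_ge (sub_nonpos.2 (hmin.insertCost_le_insertCost h₁ h₂ hu hua))

theorem IsPenalizedLSE.not_constOn_left (hmin : IsPenalizedLSE L q (fun i => θ i + ε i) τ)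
    (hε : NoiseBound ε q) (hq : 10 ^ 8 ≤ q) (hL : 10 ^ 8 ≤ L) (h₁ : Consec n τ t₁ a)
    (h₂ : Consec n τ a b) (hu : t₁ ≤ u) (hua : u < a) (hfar : t₁ < u → b + u ≤ 2 * a) :
    ¬ ConstOn θ r u b := fun hθ => by
  have hu₁ := h₁.one_le.trans hu
  have hY := hε.sq_cusum_le_of_constOn (by linarith) hu₁ hua h₂.lt h₂.le_succ hθ
  have hT := le_thresholdSq q hu₁ hua h₂.lt h₂.le_succ
  have hlt := hmin.lt_sq_cusum hq (by linarith) h₁ h₂ hu hua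
    fun h => by linarith [hfar h]
  nlinarith

theorem IsPenalizedLSE.not_constOn_right (hmin : IsPenalizedLSE L q (fun i => θ i + ε i) τ)
    (hε : NoiseBound ε q) (hq : 10 ^ 8 ≤ q) (hL : 10 ^ 8 ≤ L) (h₂ : Consec n τ a b)
    (h₃ : Consec n τ b t₃) (hbw : b < w) (hw : w ≤ t₃) (hfar : w < t₃ → 2 * b ≤ a + w) :
    ¬ ConstOn θ r a w := fun hθ => by
  have := h₃.le_succ
  have := h₂.lt
  exact (hmin.reflect h₂.n_pos).not_constOn_left (θ := θ ∘ Fin.rev) hε.reflect hq hL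
    h₃.reflect h₂.reflect (by omega) (by omega) (fun h => by omega) hθ.reflect

end Optimality

/-! ### A jump between two consecutive entries of a minimizer -/

section JumpBetween

variable {n : ℕ} {q L : ℝ} {Y θ ε : Fin n → ℝ} {τ : Finset ℕ} {r r₁ r₂ : ℝ}
  {t₁ u a s b w t₃ : ℕ}

theorem IsPenalizedLSE.sub_lt_of_jump_right (hmin : IsPenalizedLSE L q (fun i => θ i + ε i) τ)
    (hε : NoiseBound ε q) (hq : 10 ^ 9 ≤ q) (hL : 10 ^ 8 ≤ L) (h₁ : Consec n τ t₁ a)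
    (h₂ : Consec n τ a b) (hu : t₁ ≤ u) (hua : u < a) (has : a < s) (hsb : s < b)
    (hθ₁ : ConstOn θ r₁ u s) (hθ₂ : ConstOn θ r₂ s b) (hfar : t₁ < u → u + s ≤ 2 * a) :
    s - a < 10 ^ 6 * (b - s) := by
  by_contra! hnear
  have hu₁ := h₁.one_le.trans hu
  have hθ := hε.sq_cusum_signal_le_of_near_right hq hL hu₁ hua has hsb h₂.le_succ hθ₁ hθ₂ hnear
    (hmin.insertCost_nonneg h₂ has hsb)
  have hY := hε.sq_cusum_observation_le (θ := θ) (by linarith) hu₁ hua h₂.lt h₂.le_succ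
  have hlt := hmin.lt_sq_cusum (by linarith) (by linarith) h₁ h₂ hu hua
    fun h => by have := hfar h; omega
  have hT := le_thresholdSq q hu₁ hua h₂.lt h₂.le_succ
  have hsegPen := mul_le_mul_of_nonneg_left (segPen_le_thresholdSq (q := q)
    (Nat.cast_pos.2 h₁.n_pos) (sub_pos.2 (Nat.cast_lt.2 hua)) (sub_pos.2 (Nat.cast_lt.2 h₂.lt)))
    (by linarith : 0 ≤ L)
  nlinarith

theorem IsPenalizedLSE.sub_lt_of_jump_left (hmin : IsPenalizedLSE L q (fun i => θ i + ε i) τ)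
    (hε : NoiseBound ε q) (hq : 10 ^ 9 ≤ q) (hL : 10 ^ 8 ≤ L) (h₂ : Consec n τ a b)
    (h₃ : Consec n τ b t₃) (has : a < s) (hsb : s < b) (hbw : b < w) (hw : w ≤ t₃)
    (hθ₁ : ConstOn θ r₁ a s) (hθ₂ : ConstOn θ r₂ s w) (hfar : w < t₃ → 2 * b ≤ s + w) :
    b - s < 10 ^ 6 * (s - a) := by
  have := h₃.le_succ
  have h := (hmin.reflect h₂.n_pos).sub_lt_of_jump_right (θ := θ ∘ Fin.rev) hε.reflect hq hL
    h₃.reflect h₂.reflect (u := n + 2 - w) (s := n + 2 - s) (by omega) (by omega) (by omega)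
    (by omega) hθ₂.reflect hθ₁.reflect (fun h => by omega)
  omega

/-- Once a jump `s` following the entry `a` of a minimizer is inserted, `g` is the gain from
removing `a`, or from moving it back to `u`; here `t₁` is the entry preceding `a`. -/
def IsTrimGainLeft (L q : ℝ) (Y : Fin n → ℝ) (t₁ u a s : ℕ) (g : ℝ) : Prop :=
  g = insertCost L q Y t₁ a s ∨
    t₁ < u ∧ g = insertCost L q Y u a s - insertCost L q Y t₁ u a

/-- The counterpart of `IsTrimGainLeft` for the entry `b` that follows the jump `s`: it is removed,
or moved forward to `w`, and `t₃` is the entry following it. -/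
def IsTrimGainRight (L q : ℝ) (Y : Fin n → ℝ) (s b w t₃ : ℕ) (g : ℝ) : Prop :=
  g = insertCost L q Y s b t₃ ∨
    w < t₃ ∧ g = insertCost L q Y s b w - insertCost L q Y b w t₃

theorem isTrimGainLeft_rev {g : ℝ} (hs : s ≤ n + 2) (hb : b ≤ n + 2) (hw : w ≤ n + 2)
    (ht₃ : t₃ ≤ n + 2) :
    IsTrimGainLeft L q (Y ∘ Fin.rev) (n + 2 - t₃) (n + 2 - w) (n + 2 - b) (n + 2 - s) g ↔
      IsTrimGainRight L q Y s b w t₃ g := by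
  have hlt : n + 2 - t₃ < n + 2 - w ↔ w < t₃ := by omega
  unfold IsTrimGainLeft IsTrimGainRight
  rw [insertCost_rev L q Y hs hb ht₃, insertCost_rev L q Y hs hb hw, insertCost_rev L q Y hb hw ht₃,
    hlt]

theorem IsPenalizedLSE.exists_isTrimGainLeft (hmin : IsPenalizedLSE L q (fun i => θ i + ε i) τ)
    (hε : NoiseBound ε q) (hq : 10 ^ 8 ≤ q) (hL : 10 ^ 8 ≤ L) (h₁ : Consec n τ t₁ a)
    (hu : t₁ ≤ u) (hua : u < a) (has : a < s) (hs : s ≤ n + 1) (hθ : ConstOn θ r u s)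
    (hfar : t₁ < u → u + s ≤ 2 * a) :
    ∃ g, IsTrimGainLeft L q (fun i => θ i + ε i) t₁ u a s g ∧
      (0.6 * (L * segPen n q ((s : ℝ) - a)) ≤ g ∨
        0.48 * (L * segPen n q ((s : ℝ) - a)) ≤ g ∧ t₁ < u ∧ (a : ℝ) - u ≤ 2 * ((s : ℝ) - a) ∧
          0.96 * (L * segPen n q ((s : ℝ) - a)) ≤ insertCost L q (fun i => θ i + ε i) t₁ a s +
            (insertCost L q (fun i => θ i + ε i) u a s -
              insertCost L q (fun i => θ i + ε i) t₁ u a)) := by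
  have hn : (0 : ℝ) < n := Nat.cast_pos.2 h₁.n_pos
  have hy : (0 : ℝ) < (a : ℝ) - u := sub_pos.2 (Nat.cast_lt.2 hua)
  have hz : (0 : ℝ) < (s : ℝ) - a := sub_pos.2 (Nat.cast_lt.2 has)
  have hzn := cast_sub_le (h₁.one_le.trans h₁.lt.le) hs
  have hseg := le_segPen (q := q) hz hzn
  have hν := hε.sq_cusum_le_of_constOn (by linarith) (h₁.one_le.trans hu) hua has hs hθ
  rcases hu.eq_or_lt with rfl | hu
  · refine ⟨_, .inl rfl, .inl ?_⟩
    have hT := segPen_le_thresholdSq (q := q) hn hy hz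
    unfold insertCost
    nlinarith
  · have hx : (0 : ℝ) < (u : ℝ) - t₁ := sub_pos.2 (Nat.cast_lt.2 hu)
    have hzy : (s : ℝ) - a ≤ (a : ℝ) - u := by
      have : (u : ℝ) + s ≤ 2 * a := by exact_mod_cast hfar hu
      linarith
    have hT := thresholdSq_le_segPen_add_of_le (q := q) hn hy hz (hzy.trans_eq (one_mul _).symm)
    have hgain := removal_gain_ge_or_moving_gain_ge_or_add_ge hn hq (by linarith) hx hy hz hzn
      (hν.trans (by nlinarith)) (sub_nonneg.1 (hmin.insertCost_nonneg h₁ hu hua))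
      (cusum_left _ hu hua has) hzy
    rw [sub_add_sub_cancel'] at hgain
    rcases hgain with hremove | hmove | ⟨hyz, hadd⟩
    · exact ⟨_, .inl rfl, .inl hremove⟩
    · exact ⟨_, .inr ⟨hu, rfl⟩, .inl hmove⟩
    · rcases le_total (0.48 * (L * segPen n q ((s : ℝ) - a)))
        (insertCost L q (fun i => θ i + ε i) t₁ a s) with hle | hle
      · exact ⟨_, .inl rfl, .inr ⟨hle, hu, hyz, hadd⟩⟩
      · refine ⟨_, .inr ⟨hu, rfl⟩, .inr ⟨?_, hu, hyz, hadd⟩⟩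
        unfold insertCost at hle ⊢
        linarith

theorem IsPenalizedLSE.exists_isTrimGainRight (hmin : IsPenalizedLSE L q (fun i => θ i + ε i) τ)
    (hε : NoiseBound ε q) (hq : 10 ^ 8 ≤ q) (hL : 10 ^ 8 ≤ L) (h₃ : Consec n τ b t₃)
    (hs : 1 ≤ s) (hsb : s < b) (hbw : b < w) (hw : w ≤ t₃) (hθ : ConstOn θ r s w)
    (hfar : w < t₃ → 2 * b ≤ s + w) :
    ∃ g, IsTrimGainRight L q (fun i => θ i + ε i) s b w t₃ g ∧
      (0.6 * (L * segPen n q ((b : ℝ) - s)) ≤ g ∨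
        0.48 * (L * segPen n q ((b : ℝ) - s)) ≤ g ∧ w < t₃ ∧ (w : ℝ) - b ≤ 2 * ((b : ℝ) - s) ∧
          0.96 * (L * segPen n q ((b : ℝ) - s)) ≤ insertCost L q (fun i => θ i + ε i) s b t₃ +
            (insertCost L q (fun i => θ i + ε i) s b w -
              insertCost L q (fun i => θ i + ε i) b w t₃)) := by
  have := h₃.le_succ
  have hs₂ : s ≤ n + 2 := by omega
  have hb₂ : b ≤ n + 2 := by omega
  have hw₂ : w ≤ n + 2 := by omega
  have ht₂ : t₃ ≤ n + 2 := by omega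
  have h := (hmin.reflect h₃.n_pos).exists_isTrimGainLeft (θ := θ ∘ Fin.rev) hε.reflect hq hL
    h₃.reflect (u := n + 2 - w) (s := n + 2 - s) (by omega) (by omega) (by omega) (by omega)
    hθ.reflect (fun h => by omega)
  have hrev : (fun i => (θ ∘ Fin.rev) i + ε i.rev) = (fun i => θ i + ε i) ∘ Fin.rev := rfl
  rw [hrev, insertCost_rev L q _ hs₂ hb₂ ht₂, insertCost_rev L q _ hs₂ hb₂ hw₂,
    insertCost_rev L q _ hb₂ hw₂ ht₂, cast_sub_cast_reflect hs₂ hb₂,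
    cast_sub_cast_reflect hb₂ hw₂] at h
  have hlt : n + 2 - t₃ < n + 2 - w ↔ w < t₃ := by omega
  simpa only [isTrimGainLeft_rev hs₂ hb₂ hw₂ ht₂, hlt] using h

theorem IsPenalizedLSE.segCost_add_segCost_add_segCost_le (hmin : IsPenalizedLSE L q Y τ)
    (h₁ : Consec n τ t₁ a) (h₂ : Consec n τ a b) (h₃ : Consec n τ b t₃) {l : List ℕ}
    (hl : (t₁ :: (l ++ [t₃])).IsChain (· < ·)) :
    segCost L q Y t₁ a + (segCost L q Y a b + segCost L q Y b t₃) ≤ chainCost L q Y t₁ l t₃ :=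
  hmin.chainCost_le (l₀ := [a, b]) h₁.left h₃.right (by simp [h₁.lt, h₂.lt, h₃.lt])
    (by simp [h₁.mem h₂, h₂.mem h₃]) (fun x hx hx₁ hx₃ => by
      rcases (h₁.gap x hx hx₁).eq_or_lt with heq | hlt
      · simp [heq]
      rcases (h₂.gap x hx hlt).eq_or_lt with heq | hlt
      · simp [heq]
      · exact absurd (h₃.gap x hx hlt) (not_le.2 hx₃)) hl

theorem IsPenalizedLSE.trimGain_add_trimGain_le (hmin : IsPenalizedLSE L q Y τ)
    (h₁ : Consec n τ t₁ a) (h₂ : Consec n τ a b) (h₃ : Consec n τ b t₃) (hua : u < a)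
    (has : a < s) (hsb : s < b) (hbw : b < w) {g g' : ℝ} (hg : IsTrimGainLeft L q Y t₁ u a s g)
    (hg' : IsTrimGainRight L q Y s b w t₃ g') : g + g' ≤ insertCost L q Y a s b := by
  have hcost {x y z : ℕ} (hxy : x < y) (hyz : y < z) :=
    segCost_add_segCost L q Y h₁.n_pos hxy hyz
  have hle {l : List ℕ} := hmin.segCost_add_segCost_add_segCost_le h₁ h₂ h₃ (l := l)
  have has₃ := hsb.trans h₃.lt
  have hts := h₁.lt.trans has
  have hasb := hcost has hsb
  rcases hg with rfl | ⟨hu, rfl⟩ <;> rcases hg' with rfl | ⟨hw, rfl⟩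
  · have h := hle (l := [s]) (by simp [hts, has₃])
    simp only [chainCost] at h
    linarith [hcost h₁.lt has, hcost hsb h₃.lt]
  · have h := hle (l := [s, w]) (by simp [hts, hsb.trans hbw, hw])
    simp only [chainCost] at h
    linarith [hcost h₁.lt has, hcost hsb hbw, hcost hbw hw]
  · have h := hle (l := [u, s]) (by simp [hu, hua.trans has, has₃])
    simp only [chainCost] at h
    linarith [hcost hu hua, hcost hua has, hcost hsb h₃.lt]
  · have h := hle (l := [u, s, w]) (by simp [hu, hua.trans has, hsb.trans hbw, hw])
    simp only [chainCost] at h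
    linarith [hcost hu hua, hcost hua has, hcost hsb hbw, hcost hbw hw]

theorem IsPenalizedLSE.moving_gain_add_moving_gain_le (hmin : IsPenalizedLSE L q Y τ)
    (h₁ : Consec n τ t₁ a) (h₂ : Consec n τ a b) (h₃ : Consec n τ b t₃) (hu : t₁ < u)
    (hua : u < a) (has : a < s) (hsb : s < b) (hbw : b < w) (hw : w < t₃) :
    insertCost L q Y u a s - insertCost L q Y t₁ u a +
        (insertCost L q Y s b w - insertCost L q Y b w t₃) ≤
      insertCost L q Y a s b - insertCost L q Y u s w := by
  have hcost {x y z : ℕ} (hxy : x < y) (hyz : y < z) :=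
    segCost_add_segCost L q Y h₁.n_pos hxy hyz
  have h := hmin.segCost_add_segCost_add_segCost_le h₁ h₂ h₃ (l := [u, w])
    (by simp [hu, hua.trans (has.trans (hsb.trans hbw)), hw])
  simp only [chainCost] at h
  linarith [hcost has hsb, hcost hu hua, hcost hua has, hcost hsb hbw, hcost hbw hw,
    hcost (hua.trans has) (hsb.trans hbw)]

theorem NoiseBound.le_insertCost_of_wide (hε : NoiseBound ε q) (hq : 10 ^ 9 ≤ q)
    (hL : 10 ^ 8 ≤ L) (hu : 1 ≤ u) (hua : u < a) (has : a < s) (hsb : s < b) (hbw : b < w)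
    (hw : w ≤ n + 1) (hθ₁ : ConstOn θ r₁ u s) (hθ₂ : ConstOn θ r₂ s w)
    (hus : (s : ℝ) - u ≤ 3 * ((s : ℝ) - a)) (hsw : (w : ℝ) - s ≤ 3 * ((b : ℝ) - s)) :
    0.9 * (L * thresholdSq n q ((s : ℝ) - a) ((b : ℝ) - s)) -
        4 * cusum (fun i => θ i + ε i) a s b ^ 2 ≤
      insertCost L q (fun i => θ i + ε i) u s w := by
  have hn : (0 : ℝ) < n := Nat.cast_pos.2 (by omega)
  have hx : (0 : ℝ) < (s : ℝ) - a := sub_pos.2 (Nat.cast_lt.2 has)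
  have hy : (0 : ℝ) < (b : ℝ) - s := sub_pos.2 (Nat.cast_lt.2 hsb)
  have hx' : (0 : ℝ) < (s : ℝ) - u := sub_pos.2 (Nat.cast_lt.2 (hua.trans has))
  have hy' : (0 : ℝ) < (w : ℝ) - s := sub_pos.2 (Nat.cast_lt.2 (hsb.trans hbw))
  have hθ : cusum θ u s w ^ 2 ≤ 3 * cusum θ a s b ^ 2 := by
    rw [sq_cusum_eq_of_jump hu (hua.trans has) (hsb.trans hbw) hw hθ₁ hθ₂,
      sq_cusum_eq_of_jump (by omega) has hsb (by omega) (hθ₁.mono hua.le le_rfl)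
        (hθ₂.mono le_rfl hbw.le), mul_left_comm]
    refine mul_le_mul_of_nonneg_left ((mul_div_add_mono hx' hy' hus hsw).trans_eq ?_)
      (sq_nonneg _)
    field_simp
  have hY := hε.sq_cusum_observation_le (θ := θ) (by linarith) hu (hua.trans has)
    (hsb.trans hbw) hw
  have hY₀ := hε.sq_cusum_signal_le (θ := θ) (by linarith) (by omega) has hsb (by omega)
  have hT := le_thresholdSq (n := n) q (by omega) has hsb (by omega)
  have hlower := thresholdSq_anti (q := q) hn hx' hy' hus hsw
  rw [thresholdSq_mul_mul hn hx hy three_pos] at hlower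
  have hupper := thresholdSq_anti (q := q) hn hx hy
    (sub_le_sub_left (Nat.cast_le.2 hua.le) (s : ℝ))
    (sub_le_sub_right (Nat.cast_le.2 hbw.le) (s : ℝ))
  have hlog := Real.log_le_sub_one_of_pos (show (0 : ℝ) < 3 by norm_num)
  unfold insertCost
  have hscale := mul_le_mul_of_nonneg_left (show
    0.95 * thresholdSq n q ((s : ℝ) - a) ((b : ℝ) - s) ≤
      thresholdSq n q ((s : ℝ) - u) ((w : ℝ) - s) by linarith) (by linarith : 0 ≤ L)
  nlinarith

theorem IsPenalizedLSE.thresholdSq_le_segPen_of_jump_between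
    (hmin : IsPenalizedLSE L q (fun i => θ i + ε i) τ) (hε : NoiseBound ε q) (hq : 10 ^ 9 ≤ q)
    (hL : 10 ^ 8 ≤ L) (h₁ : Consec n τ t₁ a) (h₂ : Consec n τ a b) (h₃ : Consec n τ b t₃)
    (hu : t₁ ≤ u) (hua : u < a) (has : a < s) (hsb : s < b) (hbw : b < w) (hw : w ≤ t₃)
    (hθ₁ : ConstOn θ r₁ u s) (hθ₂ : ConstOn θ r₂ s w) (hfar₁ : t₁ < u → u + s ≤ 2 * a)
    (hfar₃ : w < t₃ → 2 * b ≤ s + w) :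
    0.99 * thresholdSq n q ((s : ℝ) - a) ((b : ℝ) - s) ≤ segPen n q ((s : ℝ) - a) ∧
      0.99 * thresholdSq n q ((s : ℝ) - a) ((b : ℝ) - s) ≤ segPen n q ((b : ℝ) - s) := by
  have hx : (0 : ℝ) < (s : ℝ) - a := sub_pos.2 (Nat.cast_lt.2 has)
  have hy : (0 : ℝ) < (b : ℝ) - s := sub_pos.2 (Nat.cast_lt.2 hsb)
  have hxn := cast_sub_le h₂.one_le (hsb.le.trans h₂.le_succ)
  have hyn := cast_sub_le (h₂.one_le.trans has.le) h₂.le_succ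
  have hn : (0 : ℝ) < n := Nat.cast_pos.2 h₁.n_pos
  have hnear : (s : ℝ) - a ≤ 10 ^ 6 * ((b : ℝ) - s) := by
    rw [← Nat.cast_sub has.le, ← Nat.cast_sub hsb.le]
    exact_mod_cast (hmin.sub_lt_of_jump_right hε hq hL h₁ h₂ hu hua has hsb hθ₁
      (hθ₂.mono le_rfl hbw.le) hfar₁).le
  have hnear' : (b : ℝ) - s ≤ 10 ^ 6 * ((s : ℝ) - a) := by
    rw [← Nat.cast_sub has.le, ← Nat.cast_sub hsb.le]
    exact_mod_cast (hmin.sub_lt_of_jump_left hε hq hL h₂ h₃ has hsb hbw hw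
      (hθ₁.mono hua.le le_rfl) hθ₂ hfar₃).le
  have hWr := thresholdSq_le_segPen_add_of_le (q := q) hn hx hy hnear'
  have hWl := thresholdSq_le_segPen_add_of_le (q := q) hn hy hx hnear
  rw [thresholdSq_comm] at hWl
  constructor <;> linarith [le_segPen (q := q) hx hxn, le_segPen (q := q) hy hyn]

theorem IsPenalizedLSE.false_of_jump_between (hmin : IsPenalizedLSE L q (fun i => θ i + ε i) τ)
    (hε : NoiseBound ε q) (hq : 10 ^ 9 ≤ q) (hL : 10 ^ 8 ≤ L) (h₁ : Consec n τ t₁ a)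
    (h₂ : Consec n τ a b) (h₃ : Consec n τ b t₃) (hu : t₁ ≤ u) (hua : u < a) (has : a < s)
    (hsb : s < b) (hbw : b < w) (hw : w ≤ t₃) (hθ₁ : ConstOn θ r₁ u s) (hθ₂ : ConstOn θ r₂ s w)
    (hfar₁ : t₁ < u → u + s ≤ 2 * a) (hfar₃ : w < t₃ → 2 * b ≤ s + w) : False := by
  have hL₀ : 0 ≤ L := by linarith
  obtain ⟨hl, hr⟩ := hmin.thresholdSq_le_segPen_of_jump_between hε hq hL h₁ h₂ h₃ hu hua has hsb
    hbw hw hθ₁ hθ₂ hfar₁ hfar₃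
  have hLl := mul_le_mul_of_nonneg_left hl hL₀
  have hLr := mul_le_mul_of_nonneg_left hr hL₀
  have hM : 0 < L * thresholdSq n q ((s : ℝ) - a) ((b : ℝ) - s) := mul_pos (by linarith)
    (by linarith [le_thresholdSq q h₂.one_le has hsb h₂.le_succ])
  have hins : insertCost L q (fun i => θ i + ε i) a s b =
    L * thresholdSq n q ((s : ℝ) - a) ((b : ℝ) - s) - cusum (fun i => θ i + ε i) a s b ^ 2 := rfl
  have hsq := sq_nonneg (cusum (fun i => θ i + ε i) a s b)
  obtain ⟨g, hg, hgl⟩ := hmin.exists_isTrimGainLeft hε (by linarith) hL h₁ hu hua has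
    (hsb.le.trans h₂.le_succ) hθ₁ hfar₁
  obtain ⟨g', hg', hgr⟩ := hmin.exists_isTrimGainRight hε (by linarith) hL h₃
    (h₂.one_le.trans has.le) hsb hbw hw hθ₂ hfar₃
  have hexch := hmin.trimGain_add_trimGain_le h₁ h₂ h₃ hua has hsb hbw hg hg'
  rcases hgl with hgl | ⟨hgl, hu', hau, haddl⟩ <;> rcases hgr with hgr | ⟨hgr, hw', hwb, haddr⟩
  · linarith
  · linarith
  · linarith
  · have := hmin.trimGain_add_trimGain_le h₁ h₂ h₃ hua has hsb hbw (.inl rfl) (.inl rfl)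
    have := hmin.trimGain_add_trimGain_le h₁ h₂ h₃ hua has hsb hbw
      (.inr ⟨hu', rfl⟩) (.inr ⟨hw', rfl⟩)
    have := hmin.moving_gain_add_moving_gain_le h₁ h₂ h₃ hu' hua has hsb hbw hw'
    have hwide := hε.le_insertCost_of_wide hq hL (h₁.one_le.trans hu) hua has hsb hbw
      (hw.trans h₃.le_succ) hθ₁ hθ₂ (by linarith) (by linarith)
    linarith

theorem IsPenalizedLSE.false_of_cell (hmin : IsPenalizedLSE L q (fun i => θ i + ε i) τ)
    (hε : NoiseBound ε q) (hq : 10 ^ 9 ≤ q) (hL : 10 ^ 8 ≤ L) {v : ℕ} (h₂ : Consec n τ a b)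
    (ha : a ∈ τ) (hb : b ∈ τ) (hvs : v < s) (hsw : s < w) (hθ₁ : ConstOn θ r₁ v s)
    (hθ₂ : ConstOn θ r₂ s w) (hv : v = 1 ∨ v + s ≤ 2 * a) (hw : w = n + 1 ∨ 2 * b ≤ s + w) :
    False := by
  have ha₂ := Finset.mem_Icc.1 (hmin.1 ha)
  have hb₂ := Finset.mem_Icc.1 (hmin.1 hb)
  obtain ⟨t₁, h₁⟩ := exists_consec_of_mem hmin.1 ha
  have h₃ := Consec.of_nextPoint h₂.n_pos hmin.1 (Finset.mem_insert_of_mem hb)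
  set t₃ := nextPoint n τ b
  have ht₁ := h₁.one_le
  have ht₃ := h₃.le_succ
  have ht₁a := h₁.lt
  have := h₂.lt
  have := h₃.lt
  have hθ₁ := hθ₁.mono (le_max_right t₁ v) le_rfl
  have hθ₂ := hθ₂.mono le_rfl (min_le_right t₃ w)
  rcases le_or_gt b s with hbs | hsb
  · exact hmin.not_constOn_left hε (by linarith) hL h₁ h₂ (le_max_left t₁ v) (by omega)
      (fun h => by omega) (hθ₁.mono le_rfl hbs)
  rcases le_or_gt s a with hsa | has
  · exact hmin.not_constOn_right hε (by linarith) hL h₂ h₃ (by omega) (min_le_left t₃ w)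
      (fun h => by omega) (hθ₂.mono hsa le_rfl)
  exact hmin.false_of_jump_between hε hq hL h₁ h₂ h₃ (le_max_left t₁ v) (by omega) has hsb
    (by omega) (min_le_left t₃ w) hθ₁ hθ₂ (fun h => by omega) (fun h => by omega)

end JumpBetween

/-! ### Change-points missed by a minimizer -/

section MissedChangePoint

variable {n : ℕ} {q L : ℝ} {Y θ ε : Fin n → ℝ} {τ : Finset ℕ}

theorem IsPenalizedLSE.not_isHighEnergyIn (hmin : IsPenalizedLSE L q (fun i => θ i + ε i) τ)
    (hε : NoiseBound ε q) (hL : 0 ≤ L) {s : ℕ} (hs : s ∈ Finset.Icc 2 n) (hsτ : s ∉ τ) :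
    ¬ IsHighEnergyIn θ (√L + 2) q (insert s τ) s := by
  obtain ⟨t₁, t₃, h, h₁, h₃⟩ := exists_consec_of_notMem hmin.1 hs hsτ
  unfold IsHighEnergyIn IsHighEnergy energy
  rw [(h.insert_left h₁ h₃).prevPoint_eq h₁ le_rfl, (h.insert_right h₁ h₃).nextPoint_eq, not_lt]
  have hY : |cusum (fun i => θ i + ε i) t₁ s t₃| ≤ √L * threshold n q t₁ s t₃ := by
    rw [threshold_eq, ← Real.sqrt_mul hL]
    exact Real.abs_le_sqrt (sub_nonneg.1 (hmin.insertCost_nonneg h h₁ h₃))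
  have hθ : cusum θ t₁ s t₃ = cusum (fun i => θ i + ε i) t₁ s t₃ - cusum ε t₁ s t₃ := by
    rw [cusum_add, add_sub_cancel_right]
  calc |cusum θ t₁ s t₃| ≤ |cusum (fun i => θ i + ε i) t₁ s t₃| + |cusum ε t₁ s t₃| :=
        hθ ▸ abs_sub _ _
    _ ≤ √L * threshold n q t₁ s t₃ + 2 * threshold n q t₁ s t₃ :=
        add_le_add hY (hε t₁ s t₃ h.one_le h₁ h₃ h.le_succ)
    _ = (√L + 2) * threshold n q t₁ s t₃ := (add_mul _ _ _).symm

theorem IsPenalizedLSE.sq_cusum_le_of_refine (hmin : IsPenalizedLSE L q Y τ) (hL : 0 ≤ L)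
    (hq : 0 ≤ q) {t₁ t₃ l s h e : ℕ} (hc : Consec n τ t₁ t₃) (he : 1 ≤ e)
    (hl : l = t₁ ∨ t₁ + e ≤ l) (hls : l + e ≤ s) (hsh : s + e ≤ h) (hh : h = t₃ ∨ h + e ≤ t₃) :
    cusum Y l s h ^ 2 ≤ 3 * (L * thresholdSq n q e e) := by
  have hn : (0 : ℝ) < n := Nat.cast_pos.2 hc.n_pos
  have he₀ : (0 : ℝ) < e := Nat.cast_pos.2 he
  have hanti {u x w : ℕ} (hux : u + e ≤ x) (hxw : x + e ≤ w) :
      L * thresholdSq n q ((x : ℝ) - u) ((w : ℝ) - x) ≤ L * thresholdSq n q e e :=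
    mul_le_mul_of_nonneg_left (thresholdSq_anti hn he₀ he₀
      (le_sub_iff_add_le'.2 (by exact_mod_cast hux))
      (le_sub_iff_add_le'.2 (by exact_mod_cast hxw))) hL
  have hins {u x w : ℕ} (hux : u + e ≤ x) (hxw : x + e ≤ w) :
      insertCost L q Y u x w ≤ L * thresholdSq n q e e :=
    (sub_le_self _ (sq_nonneg _)).trans (hanti hux hxw)
  have hcost {x y z : ℕ} (hxy : x < y) (hyz : y < z) :=
    segCost_add_segCost L q Y hc.n_pos hxy hyz
  have hT : 0 ≤ L * thresholdSq n q e e :=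
    (mul_nonneg hL (hq.trans (le_thresholdSq q (by have := hc.one_le; omega) (by omega : l < s)
      (by omega : s < h) (by have := hc.le_succ; omega)))).trans (hanti hls hsh)
  suffices hsuff : -(2 * (L * thresholdSq n q e e)) ≤ insertCost L q Y l s h by
    have := hanti hls hsh
    unfold insertCost at hsuff
    linarith
  rcases hl with rfl | hl <;> rcases hh with rfl | hh
  · linarith [hmin.insertCost_nonneg hc (by omega : l < s) (by omega)]
  · have hchain := hmin.segCost_le_chainCost hc (l := [s, h]) (by simp; omega)
    simp only [chainCost] at hchain
    linarith [hins (by omega : l + e ≤ h) hh, hcost (by omega : l < s) (by omega : s < h),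
      hcost (by omega : l < h) (by omega : h < t₃)]
  · have hchain := hmin.segCost_le_chainCost hc (l := [l, s]) (by simp; omega)
    simp only [chainCost] at hchain
    linarith [hins hl (by omega : l + e ≤ h), hcost (by omega : l < s) (by omega : s < h),
      hcost (by omega : t₁ < l) (by omega : l < h)]
  · have hchain := hmin.segCost_le_chainCost hc (l := [l, s, h]) (by simp; omega)
    simp only [chainCost] at hchain
    linarith [hins hl (by omega : l + e ≤ t₃), hins (by omega : l + e ≤ h) hh,
      hcost (by omega : l < s) (by omega : s < h), hcost (by omega : l < h) (by omega : h < t₃),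
      hcost (by omega : t₁ < l) (by omega : l < t₃)]

theorem exists_consec_of_forall_lt_abs (hτ : τ ⊆ Finset.Icc 2 n) {v s w : ℕ} {d : ℝ} (hv : 1 ≤ v)
    (hvs : v < s) (hsw : s < w) (hw : w ≤ n + 1) (hd : 0 ≤ d) (hdl : d ≤ (s : ℝ) - v)
    (hdr : d ≤ (w : ℝ) - s) (hfar : ∀ t ∈ τ, d < |(t : ℝ) - s|) :
    ∃ t₁ t₃, Consec n τ t₁ t₃ ∧ t₁ < s ∧ s < t₃ ∧ d ≤ (s : ℝ) - t₁ ∧ d ≤ (t₃ : ℝ) - s := by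
  have hsτ : s ∉ τ := fun h => by
    have := hfar s h
    rw [sub_self, abs_zero] at this
    linarith
  obtain ⟨t₁, t₃, h, h₁, h₃⟩ :=
    exists_consec_of_notMem hτ (Finset.mem_Icc.2 ⟨by omega, by omega⟩) hsτ
  refine ⟨t₁, t₃, h, h₁, h₃, ?_, ?_⟩
  · rcases Finset.mem_insert.1 h.left with rfl | ht₁
    · exact hdl.trans (sub_le_sub_left (Nat.cast_le.2 hv) _)
    · have := hfar t₁ ht₁
      rw [abs_sub_comm, abs_of_pos (sub_pos.2 (Nat.cast_lt.2 h₁))] at this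
      exact this.le
  · rcases Finset.mem_insert.1 h.right with rfl | ht₃
    · exact hdr.trans (sub_le_sub_right (Nat.cast_le.2 hw) _)
    · have := hfar t₃ ht₃
      rw [abs_of_pos (sub_pos.2 (Nat.cast_lt.2 h₃))] at this
      exact this.le

theorem exists_refinement {t₁ t₃ v s w e : ℕ} (he : 1 ≤ e) (h₁ : t₁ + e ≤ s) (h₃ : s + e ≤ t₃)
    (hv : v + 2 * e ≤ s + 1) (hw : s + 2 * e ≤ w + 1) :
    ∃ l h, (l = t₁ ∨ t₁ + e ≤ l) ∧ l + e ≤ s ∧ v ≤ l ∧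
      (h = t₃ ∨ h + e ≤ t₃) ∧ s + e ≤ h ∧ h ≤ w := by
  have hl : ∃ l, (l = t₁ ∨ t₁ + e ≤ l) ∧ l + e ≤ s ∧ v ≤ l := by
    rcases lt_or_ge s (t₁ + 2 * e) with hs | hs
    · exact ⟨t₁, by omega⟩
    · exact ⟨s - e, by omega⟩
  have hh : ∃ h, (h = t₃ ∨ h + e ≤ t₃) ∧ s + e ≤ h ∧ h ≤ w := by
    rcases lt_or_ge t₃ (s + 2 * e) with hs | hs
    · exact ⟨t₃, by omega⟩
    · exact ⟨s + e, by omega⟩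
  obtain ⟨l, hl₁, hls, hvl⟩ := hl
  obtain ⟨h, hh₃, hsh, hhw⟩ := hh
  exact ⟨l, h, hl₁, hls, hvl, hh₃, hsh, hhw⟩

theorem add_ceil_le {d : ℝ} {a b : ℕ} (hd : d ≤ (b : ℝ) - a) (hab : a ≤ b) : a + ⌈d⌉₊ ≤ b := by
  have : ⌈d⌉₊ ≤ b - a := Nat.ceil_le.2 (by rwa [Nat.cast_sub hab])
  omega

theorem add_two_mul_ceil_le {d : ℝ} {a b : ℕ} (hd₀ : 0 ≤ d) (hd : d ≤ ((b : ℝ) - a) / 2) :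
    a + 2 * ⌈d⌉₊ ≤ b + 1 := by
  have hceil := Nat.ceil_lt_add_one hd₀
  have : (a : ℝ) + 2 * ⌈d⌉₊ < b + 2 := by linarith
  exact Nat.lt_succ_iff.1 (by exact_mod_cast this)

theorem IsPenalizedLSE.mul_sq_jump_le (hmin : IsPenalizedLSE L q (fun i => θ i + ε i) τ)
    (hε : NoiseBound ε q) (hq : 0 ≤ q) (hL : 100 ≤ L) {v s w : ℕ} {r₁ r₂ d : ℝ} (hv : 1 ≤ v)
    (hvs : v < s) (hsw : s < w) (hw : w ≤ n + 1) (hθ₁ : ConstOn θ r₁ v s)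
    (hθ₂ : ConstOn θ r₂ s w) (hd : 0 < d) (hdl : d ≤ ((s : ℝ) - v) / 2)
    (hdr : d ≤ ((w : ℝ) - s) / 2) (hfar : ∀ t ∈ τ, d < |(t : ℝ) - s|) :
    d * (r₂ - r₁) ^ 2 ≤ 8 * L * thresholdSq n q d d := by
  obtain ⟨t₁, t₃, hc, h₁, h₃, hd₁, hd₃⟩ := exists_consec_of_forall_lt_abs hmin.1 hv hvs hsw hw
    hd.le (by linarith) (by linarith) hfar
  have he : 1 ≤ ⌈d⌉₊ := Nat.ceil_pos.2 hd
  obtain ⟨l, h, hl, hls, hvl, hh, hsh, hhw⟩ := exists_refinement he (add_ceil_le hd₁ h₁.le)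
    (add_ceil_le hd₃ h₃.le) (add_two_mul_ceil_le hd.le hdl) (add_two_mul_ceil_le hd.le hdr)
  have hde : d ≤ ⌈d⌉₊ := Nat.le_ceil d
  generalize ⌈d⌉₊ = e at *
  have hn : (0 : ℝ) < n := Nat.cast_pos.2 hc.n_pos
  have he₀ : (0 : ℝ) < e := hd.trans_le hde
  have hls₁ : l < s := by omega
  have hsh₁ : s < h := by omega
  have hx : (e : ℝ) ≤ (s : ℝ) - l := le_sub_iff_add_le'.2 (by exact_mod_cast hls)
  have hy : (e : ℝ) ≤ (h : ℝ) - s := le_sub_iff_add_le'.2 (by exact_mod_cast hsh)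
  have hY := hmin.sq_cusum_le_of_refine (by linarith) hq hc he hl hls hsh hh
  have hθ := hε.sq_cusum_signal_le (θ := θ) hq (by omega) hls₁ hsh₁ (by omega)
  rw [sq_cusum_eq_of_jump (by omega) hls₁ hsh₁ (by omega) (hθ₁.mono hvl le_rfl)
    (hθ₂.mono le_rfl hhw)] at hθ
  have hT := le_thresholdSq (n := n) q (by omega) hls₁ hsh₁ (by omega)
  have hTe := thresholdSq_anti (q := q) hn he₀ he₀ hx hy
  have hTd := thresholdSq_anti (q := q) hn hd hd hde hde
  have hhalf : (e : ℝ) / 2 ≤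
      ((s : ℝ) - l) * ((h : ℝ) - s) / ((s : ℝ) - l + ((h : ℝ) - s)) := by
    refine (mul_div_add_mono he₀ he₀ hx hy).trans_eq' ?_
    field_simp
    norm_num
  calc d * (r₂ - r₁) ^ 2 ≤ 2 * ((r₂ - r₁) ^ 2 * (e / 2)) := by
        linarith [mul_le_mul_of_nonneg_right hde (sq_nonneg (r₂ - r₁))]
    _ ≤ 2 * (4 * L * thresholdSq n q e e) := by
        nlinarith [mul_le_mul_of_nonneg_left hhalf (sq_nonneg (r₂ - r₁))]
    _ ≤ 8 * L * thresholdSq n q d d := by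
        linarith [mul_le_mul_of_nonneg_left hTd (by linarith : 0 ≤ 8 * L)]

end MissedChangePoint

/-! ### The change-points of the signal -/

section ChangePoints

variable {n : ℕ} {q L κ : ℝ} {θ ε : Fin n → ℝ} {τ : Finset ℕ} {K : ℕ} {τs : ℕ → ℕ} {μ : ℕ → ℝ}

theorem HasChangePoints.one_le (h : HasChangePoints θ K τs μ) {j : ℕ} (hj : j ≤ K + 1) :
    1 ≤ τs j := by
  induction j with
  | zero => rw [h.first]
  | succ j ih => exact (ih (by omega)).trans (h.lt_succ j (by omega)).le

theorem HasChangePoints.le_succ (h : HasChangePoints θ K τs μ) {j : ℕ} (hj : j ≤ K + 1) :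
    τs j ≤ n + 1 := by
  induction hj using Nat.decreasingInduction with
  | self => rw [h.last]
  | of_succ j hj ih => exact (h.lt_succ j (by omega)).le.trans ih

theorem HasChangePoints.constOn_left (h : HasChangePoints θ K τs μ) {k : ℕ}
    (hk : k ∈ Finset.Icc 1 K) : ConstOn θ (μ k) (τs (k - 1)) (τs k) :=
  h.value k (Finset.Icc_subset_Icc_right K.le_succ hk)

theorem HasChangePoints.constOn_right (h : HasChangePoints θ K τs μ) {k : ℕ} (hk : k ≤ K) :
    ConstOn θ (μ (k + 1)) (τs k) (τs (k + 1)) :=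
  h.value (k + 1) (Finset.mem_Icc.2 ⟨by omega, by omega⟩)

theorem HasChangePoints.lt_left (h : HasChangePoints θ K τs μ) {k : ℕ}
    (hk : k ∈ Finset.Icc 1 K) : τs (k - 1) < τs k := by
  rw [Finset.mem_Icc] at hk
  simpa only [Nat.sub_add_cancel hk.1] using h.lt_succ (k - 1) (by omega)

theorem HasChangePoints.mem_Icc (h : HasChangePoints θ K τs μ) {k : ℕ}
    (hk : k ∈ Finset.Icc 1 K) : τs k ∈ Finset.Icc 2 n := by
  have hlt := h.lt_left hk
  rw [Finset.mem_Icc] at hk ⊢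
  have := h.lt_succ k hk.2
  have := h.one_le (j := k - 1) (by omega)
  have := h.le_succ (j := k + 1) (by omega)
  omega

theorem IsPenalizedLSE.noSp (hmin : IsPenalizedLSE L q (fun i => θ i + ε i) τ)
    (hθ : HasChangePoints θ K τs μ) (hε : NoiseBound ε q) (hq : 10 ^ 9 ≤ q)
    (hL : 10 ^ 8 ≤ L) : NoSp K τs τ := by
  intro k hk
  by_contra! hcard
  rw [Set.one_lt_ncard (τ.finite_toSet.subset (Set.sep_subset _ _))] at hcard
  obtain ⟨a, ha, c, hc, hac⟩ := hcard
  wlog hlt : a < c generalizing a c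
  · exact this c hc a ha hac.symm (lt_of_le_of_ne (not_lt.1 hlt) hac.symm)
  obtain ⟨haτ : a ∈ τ, hleft, -⟩ := ha
  obtain ⟨hcτ : c ∈ τ, -, hright⟩ := hc
  have hcn := Finset.mem_Icc.1 (hmin.1 hcτ)
  have hab := Consec.of_nextPoint (by omega) hmin.1 (Finset.mem_insert_of_mem haτ)
  have hbc : nextPoint n τ a ≤ c := hab.gap c hcτ hlt
  have hbτ : nextPoint n τ a ∈ τ := (Finset.mem_insert.1 hab.right).resolve_left (by omega)
  refine hmin.false_of_cell hε hq hL hab haτ hbτ (hθ.lt_left hk)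
    (hθ.lt_succ k (Finset.mem_Icc.1 hk).2) (hθ.constOn_left hk)
    (hθ.constOn_right (Finset.mem_Icc.1 hk).2)
    (hleft.imp (fun h => ?_) fun h => ?_) (hright.imp (fun h => ?_) fun h => ?_)
  · rw [h, hθ.first]
  · have : (τs (k - 1) : ℝ) + τs k ≤ 2 * a := by linarith
    exact_mod_cast this
  · rw [h, hθ.last]
  · have : 2 * (c : ℝ) ≤ τs k + τs (k + 1) := by linarith
    exact (Nat.mul_le_mul_left 2 hbc).trans (by exact_mod_cast this)

theorem IsHighEnergy.lt_sq_jump_mul {v s w : ℕ} {r₁ r₂ : ℝ} (h : IsHighEnergy θ κ q v s w)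
    (hκ : 1 ≤ κ) (hq : 0 ≤ q) (hv : 1 ≤ v) (hvs : v < s) (hsw : s < w) (hw : w ≤ n + 1)
    (hθ₁ : ConstOn θ r₁ v s) (hθ₂ : ConstOn θ r₂ s w) :
    κ * segPen n q ((s : ℝ) - v) < (r₂ - r₁) ^ 2 * ((s : ℝ) - v) ∧
      κ * segPen n q ((w : ℝ) - s) < (r₂ - r₁) ^ 2 * ((w : ℝ) - s) := by
  have hn : (0 : ℝ) < n := Nat.cast_pos.2 (by omega)
  have hx : (0 : ℝ) < (s : ℝ) - v := sub_pos.2 (Nat.cast_lt.2 hvs)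
  have hy : (0 : ℝ) < (w : ℝ) - s := sub_pos.2 (Nat.cast_lt.2 hsw)
  have hT := hq.trans (le_thresholdSq q hv hvs hsw hw)
  have hE : κ * thresholdSq n q ((s : ℝ) - v) ((w : ℝ) - s) <
      (r₂ - r₁) ^ 2 * (((s : ℝ) - v) * ((w : ℝ) - s) / ((s : ℝ) - v + ((w : ℝ) - s))) := by
    rw [← sq_cusum_eq_of_jump hv hvs hsw hw hθ₁ hθ₂, ← sq_abs (cusum _ _ _ _)]
    unfold IsHighEnergy energy at h
    rw [threshold_eq] at h
    refine (pow_lt_pow_left₀ h (by positivity) two_ne_zero).trans_le' ?_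
    rw [mul_pow, Real.sq_sqrt hT]
    exact mul_le_mul_of_nonneg_right (by nlinarith) hT
  generalize (s : ℝ) - v = x at *
  generalize (w : ℝ) - s = y at *
  have hxT := segPen_le_thresholdSq (q := q) hn hy hx
  rw [thresholdSq_comm] at hxT
  have hyT := segPen_le_thresholdSq (q := q) hn hx hy
  have hlex : x * y / (x + y) ≤ x := by
    rw [div_le_iff₀ (by positivity)]
    nlinarith
  have hley : x * y / (x + y) ≤ y := by
    rw [div_le_iff₀ (by positivity)]
    nlinarith
  exact ⟨(mul_le_mul_of_nonneg_left hxT (by linarith)).trans_lt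
      (hE.trans_le (mul_le_mul_of_nonneg_left hlex (sq_nonneg _))),
    (mul_le_mul_of_nonneg_left hyT (by linarith)).trans_lt
      (hE.trans_le (mul_le_mul_of_nonneg_left hley (sq_nonneg _)))⟩

theorem thresholdSq_half_lt_mul {m g D : ℝ} (hg : 0 < g) (hgm : g ≤ m) (hq : 8 ≤ q) (hL : 0 ≤ L)
    (hκ : 32 * L ≤ κ) (h : κ * segPen m q g < D * g) :
    8 * L * thresholdSq m q (g / 2) (g / 2) < g / 2 * D := by
  have hseg := le_segPen (q := q) hg hgm
  have hT : thresholdSq m q (g / 2) (g / 2) ≤ segPen m q g + 2 * 4 :=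
    thresholdSq_le_segPen_add (hg.trans_le hgm) (by linarith) (by linarith) hg (by
      field_simp
      norm_num)
  calc 8 * L * thresholdSq m q (g / 2) (g / 2) ≤ 8 * L * (2 * segPen m q g) :=
        mul_le_mul_of_nonneg_left (by linarith) (by linarith)
    _ = 32 * L * segPen m q g / 2 := by ring
    _ ≤ κ * segPen m q g / 2 := by
        linarith [mul_le_mul_of_nonneg_right hκ (by linarith : 0 ≤ segPen m q g)]
    _ < g / 2 * D := by linarith

theorem thresholdSq_self_lt_mul {m D : ℝ} (hD : 0 < D) (hmD : 1 ≤ m * D) (hq : 1 ≤ q)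
    (hL : 1 ≤ L) (hκ : 32 * L ≤ κ) {d : ℝ} (hd : d = κ * (Real.log (m * D) + q) / D) :
    8 * L * thresholdSq m q d d < d * D := by
  have hlog := Real.log_nonneg hmD
  have hdD : d * D = κ * (Real.log (m * D) + q) := by rw [hd, div_mul_cancel₀ _ hD.ne']
  have hlower : 32 * L * (Real.log (m * D) + q) ≤ d * D :=
    hdD ▸ mul_le_mul_of_nonneg_right hκ (by linarith)
  have hLq := mul_le_mul hL hq zero_le_one (by linarith)
  have hd₀ : 0 < d := pos_of_mul_pos_left (by nlinarith) hD.le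
  have hm : 0 < m := pos_of_mul_pos_left (by linarith) hD.le
  have htwo : 2 ≤ d * D := by nlinarith
  have hT : thresholdSq m q d d ≤ 2 * Real.log (m * D) + q := by
    have hle : m * (d + d) / (d * d) ≤ m * D := by
      rw [mul_div_assoc]
      refine mul_le_mul_of_nonneg_left ?_ hm.le
      rw [div_le_iff₀ (by positivity)]
      linarith [mul_le_mul_of_nonneg_left htwo hd₀.le]
    unfold thresholdSq
    linarith [Real.log_le_log (by positivity) hle]
  have := mul_le_mul_of_nonneg_left hT (by linarith : 0 ≤ 8 * L)
  nlinarith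

theorem IsPenalizedLSE.detec (hmin : IsPenalizedLSE L q (fun i => θ i + ε i) τ)
    (hθ : HasChangePoints θ K τs μ) (hε : NoiseBound ε q) (hq : 8 ≤ q) (hL : 100 ≤ L)
    (hκ : 32 * L ≤ κ) : Detec θ K τs μ κ q κ τ := by
  intro k hk hhigh
  have hk' := Finset.mem_Icc.1 hk
  have hvs := hθ.lt_left hk
  have hsw := hθ.lt_succ k hk'.2
  have hv := hθ.one_le (j := k - 1) (by omega)
  have hw := hθ.le_succ (j := k + 1) (by omega)
  have hx : (0 : ℝ) < (τs k : ℝ) - τs (k - 1) := sub_pos.2 (Nat.cast_lt.2 hvs)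
  have hy : (0 : ℝ) < (τs (k + 1) : ℝ) - τs k := sub_pos.2 (Nat.cast_lt.2 hsw)
  have hxn := cast_sub_le (n := n) (b := τs k) hv (by omega)
  have hyn := cast_sub_le (a := τs k) (by omega) hw
  have hjump : 0 < (μ (k + 1) - μ k) ^ 2 := by
    have := sub_ne_zero.2 (hθ.ne_succ k hk).symm
    positivity
  obtain ⟨hleft, hright⟩ := hhigh.lt_sq_jump_mul (by linarith) (by linarith) hv hvs hsw hw
    (hθ.constOn_left hk) (hθ.constOn_right hk'.2)
  have hnjump : 1 ≤ n * (μ (k + 1) - μ k) ^ 2 := by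
    nlinarith [le_segPen (q := q) hx hxn]
  by_contra! hfar
  have hle := fun hd => hmin.mul_sq_jump_le hε (by linarith) hL hv hvs hsw hw
    (hθ.constOn_left hk) (hθ.constOn_right hk'.2) hd
    ((min_le_right _ _).trans (min_le_left _ _)) (min_le_left _ _) hfar
  refine (hle ?_).not_gt ?_
  · have := Real.log_nonneg hnjump
    refine lt_min (half_pos hy) (lt_min (half_pos hx) (div_pos (mul_pos ?_ ?_) hjump)) <;>
      linarith
  rcases min_choice (((τs (k + 1) : ℝ) - τs k) / 2) (min (((τs k : ℝ) - τs (k - 1)) / 2)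
    (κ * (Real.log (n * (μ (k + 1) - μ k) ^ 2) + q) / (μ (k + 1) - μ k) ^ 2)) with h | h
  · rw [h]
    exact thresholdSq_half_lt_mul hy hyn hq (by linarith) hκ hright
  rw [h]
  rcases min_choice (((τs k : ℝ) - τs (k - 1)) / 2)
    (κ * (Real.log (n * (μ (k + 1) - μ k) ^ 2) + q) / (μ (k + 1) - μ k) ^ 2) with h' | h'
  · rw [h']
    exact thresholdSq_half_lt_mul hx hxn hq (by linarith) hκ hleft
  · rw [h']
    exact thresholdSq_self_lt_mul hjump hnjump (by linarith) (by linarith) hκ rfl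

end ChangePoints

/-! ### Chaining: from a dyadic grid to all segments -/

section Chaining

variable {n : ℕ} {q : ℝ} {x : Fin n → ℝ} {a : ℕ}

/-- The deviation allowed for the sum of the noise over `m` adjacent dyadic segments of length
`2 ^ j`. -/
def gridRadius (n q : ℝ) (j m : ℕ) : ℝ := √(m * 2 ^ j * (1.5 * segPen n q (2 ^ j)))

theorem gridRadius_nonneg (n q : ℝ) (j m : ℕ) : 0 ≤ gridRadius n q j m := Real.sqrt_nonneg _

theorem sq_gridRadius {m : ℝ} (hq : 0 ≤ q) {j : ℕ} (hj : (2 : ℝ) ^ j ≤ m) (l : ℕ) :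
    gridRadius m q j l ^ 2 = l * 2 ^ j * (1.5 * segPen m q (2 ^ j)) := by
  have := le_segPen (q := q) (by positivity) hj
  exact Real.sq_sqrt (mul_nonneg (by positivity) (by linarith))

/-- The sums of `x` over short unions of adjacent dyadic segments are controlled. The ratio `2 ^ 18`
lets every long segment be approximated by such a union up to a small fraction of its length. -/
def GridBound (x : Fin n → ℝ) (q : ℝ) : Prop :=
  ∀ j i m : ℕ, 2 ^ j ≤ n → m ≤ 2 ^ 18 →
    |segSum x (i * 2 ^ j) ((i + m) * 2 ^ j)| ≤ gridRadius n q j m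

theorem segSum_eq_zero_of_lt (x : Fin n → ℝ) (b : ℕ) (ha : n < a) : segSum x a b = 0 :=
  Finset.sum_eq_zero fun i hi => by
    have := (Finset.mem_filter.1 hi).2
    omega

theorem gridBound_of_forall_mem (h : ∀ j ∈ Finset.range (Nat.log 2 n + 1),
    ∀ i ∈ Finset.range (n / 2 ^ j + 1), ∀ m ∈ Finset.Icc 1 (2 ^ 18),
      |segSum x (i * 2 ^ j) ((i + m) * 2 ^ j)| ≤ gridRadius n q j m) : GridBound x q := by
  intro j i m hj hm
  rcases Nat.eq_zero_or_pos m with rfl | hm₀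
  · rw [add_zero, segSum_self, abs_zero]
    exact gridRadius_nonneg _ _ _ _
  rcases lt_or_ge (n / 2 ^ j) i with hi | hi
  · rw [segSum_eq_zero_of_lt x _ ((Nat.div_lt_iff_lt_mul (Nat.two_pow_pos j)).1 hi), abs_zero]
    exact gridRadius_nonneg _ _ _ _
  · exact h j (Finset.mem_range_succ_iff.2 (Nat.le_log_of_pow_le one_lt_two hj)) i
      (Finset.mem_range_succ_iff.2 hi) m (Finset.mem_Icc.2 ⟨hm₀, hm⟩)

theorem segPen_le_segPen_add {m y z : ℝ} (hm : 0 < m) (hy : 0 < y) (hz : 0 < z) :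
    segPen m q y ≤ segPen m q z + 2 * (z / y) := by
  have hlog : Real.log (m / y) = Real.log (m / z) + Real.log (z / y) := by
    rw [← Real.log_mul (by positivity) (by positivity), div_mul_div_cancel₀ hz.ne']
  unfold segPen
  linarith [Real.log_le_sub_one_of_pos (div_pos hz hy)]

theorem sqrt_mul_le_mul_sqrt_mul {c u v w : ℝ} (hc : 0 ≤ c) (hw : 0 ≤ w) (h : u ≤ c ^ 2 * v) :
    √(u * w) ≤ c * √(v * w) := by
  nth_rewrite 1 [← Real.sqrt_sq hc]
  rw [← Real.sqrt_mul (sq_nonneg c), ← mul_assoc]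
  exact Real.sqrt_le_sqrt (mul_le_mul_of_nonneg_right h hw)

theorem eleven_mul_gridRadius_le {m : ℝ} (hq : 20 ≤ q) {j : ℕ} (hj : (2 : ℝ) ^ (j + 1) ≤ m) :
    11 * gridRadius m q j 1 ≤ 10 * gridRadius m q (j + 1) 1 := by
  have hm : 0 < m := lt_of_lt_of_le (by positivity) hj
  have hpen : q ≤ segPen m q (2 ^ (j + 1)) := le_segPen (by positivity) hj
  have hratio : (2 : ℝ) ^ (j + 1) / 2 ^ j = 2 := by
    rw [pow_succ, mul_div_cancel_left₀ _ (by positivity)]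
  have hpen' := segPen_le_segPen_add (q := q) hm (by positivity : (0 : ℝ) < 2 ^ j)
    (by positivity : (0 : ℝ) < 2 ^ (j + 1))
  rw [hratio] at hpen'
  have hsqrt : gridRadius m q j 1 ≤ 10 / 11 * gridRadius m q (j + 1) 1 := by
    unfold gridRadius
    rw [mul_comm _ (1.5 * segPen m q (2 ^ j)), mul_comm _ (1.5 * segPen m q (2 ^ (j + 1))),
      pow_succ, Nat.cast_one, one_mul, one_mul, mul_comm ((2 : ℝ) ^ j) 2, ← mul_assoc _ (2 : ℝ),
      mul_comm (2 : ℝ)]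
    refine sqrt_mul_le_mul_sqrt_mul (by norm_num) (by positivity) ?_
    rw [pow_succ] at hpen hpen'
    linarith
  linarith

theorem abs_segSum_prefix_le {r : ℕ → ℝ} {C : ℝ} (hC : 1 ≤ C) (J : ℕ)
    (hgrid : ∀ j ≤ J, ∀ i, |segSum x (i * 2 ^ j) ((i + 1) * 2 ^ j)| ≤ r j)
    (hr : ∀ j < J, (1 + C) * r j ≤ C * r (j + 1)) {i l : ℕ} (hl : l ≤ 2 ^ J) :
    |segSum x (i * 2 ^ J) (i * 2 ^ J + l)| ≤ C * r J := by
  have hr₀ : ∀ j ≤ J, 0 ≤ r j := fun j hj => (abs_nonneg _).trans (hgrid j hj 0)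
  induction J generalizing i l with
  | zero =>
    have h := hgrid 0 le_rfl i
    rw [pow_zero, mul_one, mul_one] at h
    rw [pow_zero, mul_one]
    rcases Nat.le_one_iff_eq_zero_or_eq_one.1 hl with rfl | rfl
    · rw [add_zero, segSum_self, abs_zero]
      exact mul_nonneg (by linarith) (hr₀ 0 le_rfl)
    · exact h.trans (le_mul_of_one_le_left (hr₀ 0 le_rfl) hC)
  | succ J ih =>
    have hprefix : ∀ i l : ℕ, l ≤ 2 ^ J → |segSum x (i * 2 ^ J) (i * 2 ^ J + l)| ≤ C * r J :=
      fun i l hl => ih (fun j hj => hgrid j (by omega)) (fun j hj => hr j (by omega)) hl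
        fun j hj => hr₀ j (by omega)
    have hstep := hr J J.lt_succ_self
    have hrJ := hr₀ J J.le_succ
    rw [show i * 2 ^ (J + 1) = 2 * i * 2 ^ J by ring]
    rcases le_total l (2 ^ J) with hlJ | hlJ
    · linarith [hprefix (2 * i) l hlJ]
    · have hhead := hgrid J J.le_succ (2 * i)
      have htail := hprefix (2 * i + 1) (l - 2 ^ J) (by rw [pow_succ] at hl; omega)
      have hend : (2 * i + 1) * 2 ^ J + (l - 2 ^ J) = 2 * i * 2 ^ J + l := by
        rw [add_mul, one_mul]
        omega
      rw [hend] at htail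
      rw [← segSum_add_segSum x (Nat.mul_le_mul_right _ (2 * i).le_succ)
        (hend ▸ Nat.le_add_right _ _)]
      linarith [abs_add_le (segSum x (2 * i * 2 ^ J) ((2 * i + 1) * 2 ^ J))
        (segSum x ((2 * i + 1) * 2 ^ J) (2 * i * 2 ^ J + l))]

theorem GridBound.abs_segSum_prefix_le (hx : GridBound x q) (hq : 20 ≤ q) {J i l : ℕ}
    (hJ : 2 ^ J ≤ n) (hl : l ≤ 2 ^ J) :
    |segSum x (i * 2 ^ J) (i * 2 ^ J + l)| ≤ 10 * gridRadius n q J 1 := by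
  refine ChangePoint.abs_segSum_prefix_le (r := fun j => gridRadius n q j 1) (by norm_num) J
    (fun j hj i => hx j i 1 ((Nat.pow_le_pow_right two_pos hj).trans hJ) (by norm_num))
    (fun j hj => ?_) hl
  have hj' : 2 ^ (j + 1) ≤ n := (Nat.pow_le_pow_right two_pos hj).trans hJ
  exact (by norm_num : (1 : ℝ) + 10 = 11) ▸ eleven_mul_gridRadius_le hq (by exact_mod_cast hj')

theorem abs_segSum_le_add_prefix (x : Fin n → ℝ) {s e : ℕ} (hse : s ≤ e) (N : ℕ) :
    |segSum x s e| ≤ |segSum x (s / N * N) (e / N * N)| +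
      |segSum x (e / N * N) (e / N * N + e % N)| + |segSum x (s / N * N) (s / N * N + s % N)| := by
  have hs := segSum_add_segSum x (Nat.div_mul_le_self s N) hse
  have he := segSum_add_segSum x (Nat.mul_le_mul_right N (Nat.div_le_div_right (c := N) hse))
    (Nat.div_mul_le_self e N)
  rw [Nat.div_add_mod', Nat.div_add_mod', ← sub_eq_of_eq_add' hs.symm, ← he]
  exact (abs_sub _ _).trans (add_le_add_left (abs_add_le _ _) _)

theorem exists_two_pow_mul_le_lt {a k : ℕ} (ha : 2 ^ k ≤ a) :
    ∃ j, 2 ^ k * 2 ^ j ≤ a ∧ a < 2 ^ (k + 1) * 2 ^ j := by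
  have hk := Nat.le_log_of_pow_le one_lt_two ha
  refine ⟨Nat.log 2 a - k, ?_, ?_⟩ <;> rw [← pow_add]
  · rw [Nat.add_sub_cancel' hk]
    exact Nat.pow_log_le_self 2 ((Nat.two_pow_pos k).trans_le ha).ne'
  · rw [add_right_comm, Nat.add_sub_cancel' hk]
    exact Nat.lt_pow_succ_log_self one_lt_two a

theorem div_sub_div_mul_le (s a : ℕ) {N : ℕ} (hN : 0 < N) : ((s + a) / N - s / N) * N ≤ a + N := by
  have := Nat.div_mul_le_self (s + a) N
  have := Nat.lt_div_mul_add (a := s) hN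
  rw [Nat.sub_mul]
  omega

theorem GridBound.sq_segSum_le_of_short (hx : GridBound x q) (hq : 10 ^ 6 ≤ q) (s : ℕ) (ha : 0 < a)
    (han : a ≤ n) (hshort : a < 2 ^ 16) :
    segSum x s (s + a) ^ 2 ≤ 2 * (a * segPen n q a) := by
  have ha₀ : (0 : ℝ) < a := Nat.cast_pos.2 ha
  have ha' : (a : ℝ) ≤ 2 ^ 16 := by exact_mod_cast hshort.le
  have hn : (1 : ℝ) ≤ n := Nat.one_le_cast.2 (ha.trans_le han)
  have hpen := le_segPen (q := q) ha₀ (Nat.cast_le.2 han)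
  have hpen' := segPen_le_segPen_add (q := q) (by linarith : (0 : ℝ) < n) one_pos ha₀
  have hsum := pow_le_pow_left₀ (abs_nonneg _)
    (hx 0 s a (by rw [pow_zero]; omega) (by omega)) 2
  rw [sq_abs, sq_gridRadius (by linarith) (by rwa [pow_zero]), pow_zero, pow_zero, mul_one, mul_one,
    mul_one] at hsum
  rw [div_one] at hpen'
  calc segSum x s (s + a) ^ 2 ≤ a * (1.5 * segPen n q 1) := hsum
    _ ≤ a * (2 * segPen n q a) := mul_le_mul_of_nonneg_left (by linarith) ha₀.le
    _ = 2 * (a * segPen n q a) := by ring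

theorem GridBound.abs_segSum_le_of_long (hx : GridBound x q) (hq : 20 ≤ q) (s : ℕ) {j : ℕ}
    (han : a ≤ n) (hj : 2 ^ 16 * 2 ^ j ≤ a) (hj' : a < 2 ^ 17 * 2 ^ j) :
    |segSum x s (s + a)| ≤ 1.08 * √(a * (1.5 * segPen n q (2 ^ j))) := by
  have hN := Nat.two_pow_pos j
  have hjn : 2 ^ j ≤ n := by omega
  have hlen := div_sub_div_mul_le s a hN
  have hdiv : s / 2 ^ j ≤ (s + a) / 2 ^ j := Nat.div_le_div_right (Nat.le_add_right s a)
  have hcount : (s + a) / 2 ^ j - s / 2 ^ j ≤ 2 ^ 18 :=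
    Nat.le_of_mul_le_mul_right (by omega) hN
  have hmain := hx j (s / 2 ^ j) _ hjn hcount
  rw [Nat.add_sub_cancel' hdiv] at hmain
  have hhead := hx.abs_segSum_prefix_le hq (i := s / 2 ^ j) hjn (Nat.mod_lt s hN).le
  have htail := hx.abs_segSum_prefix_le hq (i := (s + a) / 2 ^ j) hjn (Nat.mod_lt (s + a) hN).le
  have hja : (2 : ℝ) ^ 16 * 2 ^ j ≤ a := by exact_mod_cast hj
  have hlen' : (((s + a) / 2 ^ j - s / 2 ^ j : ℕ) : ℝ) * 2 ^ j ≤ a + 2 ^ j := by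
    exact_mod_cast hlen
  have hpen : 0 ≤ 1.5 * segPen n q (2 ^ j) := by
    linarith [le_segPen (q := q) (by positivity : (0 : ℝ) < 2 ^ j)
      (by exact_mod_cast hjn : (2 : ℝ) ^ j ≤ n)]
  have hmain' : gridRadius n q j ((s + a) / 2 ^ j - s / 2 ^ j) ≤
      1.001 * √(a * (1.5 * segPen n q (2 ^ j))) :=
    sqrt_mul_le_mul_sqrt_mul (by norm_num) hpen (by linarith)
  have hone : gridRadius n q j 1 ≤ 1 / 256 * √(a * (1.5 * segPen n q (2 ^ j))) :=
    sqrt_mul_le_mul_sqrt_mul (by norm_num) hpen (by push_cast; linarith)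
  have := abs_segSum_le_add_prefix x (Nat.le_add_right s a) (2 ^ j)
  have := Real.sqrt_nonneg (a * (1.5 * segPen n q (2 ^ j)))
  linarith

theorem GridBound.sq_segSum_le (hx : GridBound x q) (hq : 10 ^ 9 ≤ q) (s : ℕ) (ha : 0 < a)
    (han : a ≤ n) : segSum x s (s + a) ^ 2 ≤ 2 * (a * segPen n q a) := by
  rcases lt_or_ge a (2 ^ 16) with hshort | hlong
  · exact hx.sq_segSum_le_of_short (by linarith) s ha han hshort
  obtain ⟨j, hj, hj'⟩ := exists_two_pow_mul_le_lt hlong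
  have ha₀ : (0 : ℝ) < a := Nat.cast_pos.2 ha
  have hn : (0 : ℝ) < n := Nat.cast_pos.2 (ha.trans_le han)
  have hN : (0 : ℝ) < 2 ^ j := by positivity
  have hratio : (a : ℝ) / 2 ^ j ≤ 2 ^ 17 := by
    rw [div_le_iff₀ hN]
    exact_mod_cast hj'.le
  have hpen := le_segPen (q := q) ha₀ (Nat.cast_le.2 han)
  have hpen' := segPen_le_segPen_add (q := q) hn hN ha₀
  have hpenN := le_segPen (q := q) hN
    (by exact_mod_cast (by omega : 2 ^ j ≤ n) : (2 : ℝ) ^ j ≤ n)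
  have hsum := pow_le_pow_left₀ (abs_nonneg _)
    (hx.abs_segSum_le_of_long (by linarith) s han hj hj') 2
  rw [sq_abs, mul_pow, Real.sq_sqrt (mul_nonneg ha₀.le (by linarith))] at hsum
  calc segSum x s (s + a) ^ 2 ≤ 1.08 ^ 2 * (a * (1.5 * segPen n q (2 ^ j))) := hsum
    _ = a * (1.08 ^ 2 * 1.5 * segPen n q (2 ^ j)) := by ring
    _ ≤ a * (2 * segPen n q a) := mul_le_mul_of_nonneg_left (by linarith) ha₀.le
    _ = 2 * (a * segPen n q a) := by ring

theorem GridBound.sq_segSum_div_le (hx : GridBound x q) (hq : 10 ^ 9 ≤ q) {s e : ℕ} (hs : 1 ≤ s)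
    (hse : s < e) (he : e ≤ n + 1) :
    segSum x s e ^ 2 / ((e : ℝ) - s) ≤ 2 * segPen n q ((e : ℝ) - s) := by
  have h := hx.sq_segSum_le hq s (Nat.sub_pos_of_lt hse) (by omega)
  rw [Nat.add_sub_cancel' hse.le, Nat.cast_sub hse.le] at h
  rw [div_le_iff₀ (sub_pos.2 (Nat.cast_lt.2 hse))]
  linarith

theorem sq_cusum_le_add (x : Fin n → ℝ) {t₁ t t₃ : ℕ} (h₁ : t₁ < t) (h₃ : t < t₃) :
    cusum x t₁ t t₃ ^ 2 ≤
      segSum x t₁ t ^ 2 / ((t : ℝ) - t₁) + segSum x t t₃ ^ 2 / ((t₃ : ℝ) - t) := by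
  have hy : (0 : ℝ) < (t : ℝ) - t₁ := sub_pos.2 (Nat.cast_lt.2 h₁)
  have hz : (0 : ℝ) < (t₃ : ℝ) - t := sub_pos.2 (Nat.cast_lt.2 h₃)
  unfold cusum
  rw [show (t₃ : ℝ) - t₁ = ((t : ℝ) - t₁) + ((t₃ : ℝ) - t) by ring, mul_pow,
    Real.sq_sqrt (by positivity)]
  generalize (t : ℝ) - t₁ = y at hy
  generalize (t₃ : ℝ) - t = z at hz
  generalize segSum x t₁ t = u
  generalize segSum x t t₃ = v
  have hdecomp : (v / z - u / y) ^ 2 * (y * z / (y + z)) =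
      u ^ 2 / y + v ^ 2 / z - (u + v) ^ 2 / (y + z) := by
    field_simp
    ring
  rw [hdecomp]
  exact sub_le_self _ (by positivity)

theorem GridBound.noiseBound (hx : GridBound x q) (hq : 10 ^ 9 ≤ q) : NoiseBound x q := by
  intro t₁ t t₃ h₀ h₁ h₃ h₄
  have hn : (0 : ℝ) < n := Nat.cast_pos.2 (by omega)
  have hy : (0 : ℝ) < (t : ℝ) - t₁ := sub_pos.2 (Nat.cast_lt.2 h₁)
  have hz : (0 : ℝ) < (t₃ : ℝ) - t := sub_pos.2 (Nat.cast_lt.2 h₃)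
  have hT := le_thresholdSq q h₀ h₁ h₃ h₄
  have hleft := segPen_le_thresholdSq (q := q) hn hz hy
  have hright := segPen_le_thresholdSq (q := q) hn hy hz
  rw [thresholdSq_comm] at hleft
  rw [threshold_eq]
  refine abs_le_of_sq_le_sq ?_ (by positivity)
  rw [mul_pow, Real.sq_sqrt (by linarith)]
  linarith [sq_cusum_le_add x h₁ h₃, hx.sq_segSum_div_le hq h₀ h₁ (by omega),
    hx.sq_segSum_div_le hq (by omega) h₃ h₄]

end Chaining

/-! ### The probability of the noise event -/

section Probability

variable {Ω : Type*} {n : ℕ} {ε : Fin n → Ω → ℝ} {q : ℝ}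

/-- The event that the sum of the noise over the `m` dyadic segments of length `2 ^ j` starting at
`i * 2 ^ j` exceeds the allowed deviation. -/
def badGridEvent (ε : Fin n → Ω → ℝ) (q : ℝ) (j i m : ℕ) : Set Ω :=
  {ω | gridRadius n q j m < |segSum (fun l => ε l ω) (i * 2 ^ j) ((i + m) * 2 ^ j)|}

theorem compl_noiseEvent_subset (ε : Fin n → Ω → ℝ) (hq : 10 ^ 9 ≤ q) :
    (noiseEvent ε q)ᶜ ⊆ ⋃ j ∈ Finset.range (Nat.log 2 n + 1),
      ⋃ i ∈ Finset.range (n / 2 ^ j + 1), ⋃ m ∈ Finset.Icc 1 (2 ^ 18), badGridEvent ε q j i m := by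
  refine Set.compl_subset_comm.1 fun ω hω => ?_
  simp only [Set.mem_compl_iff, Set.mem_iUnion, not_exists] at hω
  exact (gridBound_of_forall_mem (x := fun i => ε i ω)
    fun j hj i hi m hm => not_lt.1 (hω j hj i hi m hm)).noiseBound hq

variable [MeasurableSpace Ω] {P : Measure Ω}

theorem card_segment_le (n a b : ℕ) :
    (Finset.univ.filter fun i : Fin n => a ≤ (i : ℕ) + 1 ∧ (i : ℕ) + 1 < b).card ≤ b - a := by
  rw [← Nat.card_Ico]
  exact Finset.card_le_card_of_injOn (fun i => (i : ℕ) + 1) (fun i hi => by simpa using hi)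
    fun i _ j _ h => Fin.ext (by simpa using h)

theorem hasSubgaussianMGF_mono {X : Ω → ℝ} {c c' : NNReal} (h : HasSubgaussianMGF X c P)
    (hc : c ≤ c') : HasSubgaussianMGF X c' P where
  integrable_exp_mul := h.integrable_exp_mul
  mgf_le t := (h.mgf_le t).trans (by gcongr)

theorem measureReal_lt_abs_le [IsFiniteMeasure P] {X : Ω → ℝ} {c : NNReal}
    (h : HasSubgaussianMGF X c P) {t : ℝ} (ht : 0 ≤ t) :
    P.real {ω | t < |X ω|} ≤ 2 * Real.exp (-t ^ 2 / (2 * c)) := by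
  have hsub : {ω | t < |X ω|} ⊆ {ω | t ≤ X ω} ∪ {ω | t ≤ (-X) ω} := fun ω (hω : t < |X ω|) =>
    (lt_abs.1 hω).imp le_of_lt (le_of_lt (b := (-X) ω))
  linarith [(measureReal_mono hsub).trans (measureReal_union_le (μ := P) _ _), h.measure_ge_le ht,
    h.neg.measure_ge_le ht]

namespace IsNoise

theorem measurable_segSum (hε : IsNoise P ε) (a b : ℕ) :
    Measurable fun ω => segSum (fun i => ε i ω) a b :=
  Finset.measurable_sum _ fun i _ => hε.measurable i

theorem hasSubgaussianMGF_segSum (hε : IsNoise P ε) (a b : ℕ) :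
    HasSubgaussianMGF (fun ω => segSum (fun i => ε i ω) a b) (b - a : ℕ) P := by
  refine hasSubgaussianMGF_mono
    (HasSubgaussianMGF.sum_of_iIndepFun hε.indep fun i _ => hε.subgaussian i) ?_
  rw [Finset.sum_const, nsmul_one]
  exact Nat.cast_le.2 (card_segment_le n a b)

theorem measurable_cusum (hε : IsNoise P ε) (t₁ t₂ t₃ : ℕ) :
    Measurable fun ω => cusum (fun i => ε i ω) t₁ t₂ t₃ :=
  (((hε.measurable_segSum t₂ t₃).div_const _).sub
    ((hε.measurable_segSum t₁ t₂).div_const _)).mul_const _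

theorem measurableSet_noiseEvent (hε : IsNoise P ε) : MeasurableSet (noiseEvent ε q) := by
  unfold noiseEvent
  simp only [Set.ofPred_forall]
  exact .iInter fun t₁ => .iInter fun t₂ => .iInter fun t₃ => .iInter fun _ => .iInter fun _ =>
    .iInter fun _ => .iInter fun _ =>
      measurableSet_le (hε.measurable_cusum t₁ t₂ t₃).abs measurable_const

end IsNoise

theorem IsNoise.measureReal_badGridEvent_le (hε : IsNoise P ε) (hq : 0 ≤ q) {j m : ℕ}
    (hj : 2 ^ j ≤ n) (i : ℕ) (hm : 0 < m) :
    P.real (badGridEvent ε q j i m) ≤ 2 * Real.exp (-(0.75 * segPen n q (2 ^ j))) := by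
  have := hε.indep.isProbabilityMeasure
  have : (0 : ℝ) < m := Nat.cast_pos.2 hm
  refine (measureReal_lt_abs_le (hε.hasSubgaussianMGF_segSum _ _)
    (gridRadius_nonneg _ _ _ _)).trans_eq ?_
  rw [sq_gridRadius hq (by exact_mod_cast hj), ← Nat.sub_mul, Nat.add_sub_cancel_left]
  push_cast
  congr 2
  field_simp
  ring

theorem sum_sqrt_two_pow_le (J : ℕ) : ∑ j ∈ Finset.range (J + 1), √(2 ^ j) ≤ 4 * √(2 ^ J) := by
  have hsqrt : (4 / 3 : ℝ) ≤ √2 := Real.le_sqrt_of_sq_le (by norm_num)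
  induction J with
  | zero => norm_num
  | succ J ih =>
    rw [Finset.sum_range_succ, pow_succ, Real.sqrt_mul (by positivity)]
    nlinarith [Real.sqrt_nonneg (2 ^ J)]

theorem div_mul_exp_neg_segPen {m y : ℝ} (hm : 0 < m) (hy : 0 < y) (q : ℝ) :
    m / y * Real.exp (-(0.75 * segPen m q y)) = Real.exp (-(3 / 4 * q)) * √(y / m) := by
  have hexp : m / y = Real.exp (Real.log (m / y)) := (Real.exp_log (div_pos hm hy)).symm
  have hsqrt : √(y / m) = Real.exp (-Real.log (m / y) / 2) := by
    rw [Real.exp_half, ← Real.log_inv, inv_div, Real.exp_log (div_pos hy hm)]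
  rw [hsqrt, ← Real.exp_add]
  nth_rewrite 1 [hexp]
  rw [← Real.exp_add]
  unfold segPen
  ring_nf

theorem natCast_div_add_one_le {n N : ℕ} (hN : 0 < N) (hNn : N ≤ n) :
    ((n / N + 1 : ℕ) : ℝ) ≤ 2 * (n / N) := by
  have hone : (1 : ℝ) ≤ n / N := (one_le_div (Nat.cast_pos.2 hN)).2 (Nat.cast_le.2 hNn)
  have hdiv : ((n / N : ℕ) : ℝ) ≤ n / N := Nat.cast_div_le
  push_cast
  linarith

theorem sum_card_mul_exp_le (hn : 0 < n) (q : ℝ) :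
    ∑ j ∈ Finset.range (Nat.log 2 n + 1),
      ((n / 2 ^ j + 1 : ℕ) : ℝ) * Real.exp (-(0.75 * segPen n q (2 ^ j))) ≤
        8 * Real.exp (-(3 / 4 * q)) := by
  have hn₀ : (0 : ℝ) < n := Nat.cast_pos.2 hn
  have hlevel : ∀ j ∈ Finset.range (Nat.log 2 n + 1),
      ((n / 2 ^ j + 1 : ℕ) : ℝ) * Real.exp (-(0.75 * segPen n q (2 ^ j))) ≤
        2 * Real.exp (-(3 / 4 * q)) / √n * √(2 ^ j) := fun j hj => by
    have hcard := natCast_div_add_one_le (Nat.two_pow_pos j)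
      (Nat.pow_le_of_le_log hn.ne' (Finset.mem_range_succ_iff.1 hj))
    rw [Nat.cast_pow, Nat.cast_ofNat] at hcard
    refine (mul_le_mul_of_nonneg_right hcard (Real.exp_pos _).le).trans_eq ?_
    rw [mul_assoc, div_mul_exp_neg_segPen hn₀ (by positivity), Real.sqrt_div (by positivity)]
    ring
  refine (Finset.sum_le_sum hlevel).trans ?_
  rw [← Finset.mul_sum]
  have hlog : √(2 ^ Nat.log 2 n) ≤ √(n : ℝ) :=
    Real.sqrt_le_sqrt (by exact_mod_cast Nat.pow_log_le_self 2 hn.ne')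
  calc 2 * Real.exp (-(3 / 4 * q)) / √n * ∑ j ∈ Finset.range (Nat.log 2 n + 1), √(2 ^ j)
      ≤ 2 * Real.exp (-(3 / 4 * q)) / √n * (4 * √n) :=
        mul_le_mul_of_nonneg_left ((sum_sqrt_two_pow_le _).trans (by linarith)) (by positivity)
    _ = 8 * Real.exp (-(3 / 4 * q)) := by
        have := (Real.sqrt_pos.2 hn₀).ne'
        field_simp
        norm_num

theorem IsNoise.measureReal_compl_noiseEvent_le (hε : IsNoise P ε) (hn : 0 < n)
    (hq : 10 ^ 9 ≤ q) : P.real (noiseEvent ε q)ᶜ ≤ 2 ^ 22 * Real.exp (-(3 / 4 * q)) := by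
  have := hε.indep.isProbabilityMeasure
  calc P.real (noiseEvent ε q)ᶜ
      ≤ ∑ j ∈ Finset.range (Nat.log 2 n + 1), ∑ i ∈ Finset.range (n / 2 ^ j + 1),
          ∑ m ∈ Finset.Icc 1 (2 ^ 18), P.real (badGridEvent ε q j i m) :=
        (measureReal_mono (compl_noiseEvent_subset ε hq) (measure_ne_top P _)).trans <|
          (measureReal_biUnion_finset_le _ _).trans <| Finset.sum_le_sum fun _ _ =>
          (measureReal_biUnion_finset_le _ _).trans <| Finset.sum_le_sum fun _ _ =>
          measureReal_biUnion_finset_le _ _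
    _ ≤ ∑ j ∈ Finset.range (Nat.log 2 n + 1), ∑ i ∈ Finset.range (n / 2 ^ j + 1),
          ∑ m ∈ Finset.Icc 1 (2 ^ 18), 2 * Real.exp (-(0.75 * segPen n q (2 ^ j))) :=
        Finset.sum_le_sum fun j hj => Finset.sum_le_sum fun i _ => Finset.sum_le_sum fun m hm =>
          hε.measureReal_badGridEvent_le (by linarith)
            (Nat.pow_le_of_le_log hn.ne' (Finset.mem_range_succ_iff.1 hj)) i
            (Finset.mem_Icc.1 hm).1
    _ = 2 ^ 19 * ∑ j ∈ Finset.range (Nat.log 2 n + 1), ((n / 2 ^ j + 1 : ℕ) : ℝ) *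
          Real.exp (-(0.75 * segPen n q (2 ^ j))) := by
        rw [Finset.mul_sum]
        refine Finset.sum_congr rfl fun j _ => ?_
        simp only [Finset.sum_const, Finset.card_range, Nat.card_Icc, nsmul_eq_mul]
        push_cast
        ring
    _ ≤ 2 ^ 19 * (8 * Real.exp (-(3 / 4 * q))) :=
        mul_le_mul_of_nonneg_left (sum_card_mul_exp_le hn q) (by norm_num)
    _ = 2 ^ 22 * Real.exp (-(3 / 4 * q)) := by ring

theorem IsNoise.le_measureReal_noiseEvent (hε : IsNoise P ε) (hn : 0 < n) (hq : 10 ^ 9 ≤ q) :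
    1 - 2 ^ 22 * Real.exp (-(3 / 4) * q) ≤ P.real (noiseEvent ε q) := by
  have := hε.indep.isProbabilityMeasure
  have hcompl := probReal_compl_eq_one_sub (μ := P) (hε.measurableSet_noiseEvent (q := q))
  rw [neg_mul]
  linarith [hε.measureReal_compl_noiseEvent_le hn hq]

end Probability
end ChangePoint

end

theorem proposition4 :
    ∃ c > (0 : ℝ), ∃ c' > (0 : ℝ), ∃ L₀ q₀ : ℝ, ∃ n₀ : ℕ,
      ∀ L ≥ L₀, ∃ κ > (1 : ℝ), ∀ q > q₀, ∀ n > n₀,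
      ∀ K > 0, ∀ (θ : Fin n → ℝ) (τs : ℕ → ℕ) (μ : ℕ → ℝ),
        ChangePoint.HasChangePoints θ K τs μ →
      ∀ {Ω : Type*} [MeasurableSpace Ω] (P : MeasureTheory.Measure Ω)
        [MeasureTheory.IsProbabilityMeasure P] (ε : Fin n → Ω → ℝ),
        ChangePoint.IsNoise P ε →
      MeasurableSet (ChangePoint.noiseEvent ε q) ∧
      1 - c * Real.exp (-c' * q) ≤ P.real (ChangePoint.noiseEvent ε q) ∧
      ∀ ω ∈ ChangePoint.noiseEvent ε q, ∀ τ : Finset ℕ,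
        ChangePoint.IsPenalizedLSE L q (fun i => θ i + ε i ω) τ →
        ChangePoint.NoSp K τs τ ∧
        ChangePoint.Detec θ K τs μ κ q κ τ ∧
        ∀ k ∈ Finset.Icc 1 K, τs k ∈ τ ∨
          ¬ ChangePoint.IsHighEnergyIn θ (√L + 2) q (insert (τs k) τ) (τs k) := by
  refine ⟨2 ^ 22, by norm_num, 3 / 4, by norm_num, 10 ^ 8, 10 ^ 9, 0, fun L hL =>
    ⟨32 * L, by linarith, ?_⟩⟩
  intro q hq n hn K _ θ τs μ hθ Ω _ P _ ε hε
  refine ⟨hε.measurableSet_noiseEvent, hε.le_measureReal_noiseEvent hn hq.le, fun ω hω τ hτ => ?_⟩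
  have hω : ChangePoint.NoiseBound (fun i => ε i ω) q := hω
  refine ⟨hτ.noSp hθ hω (by linarith) (by linarith),
    hτ.detec hθ hω (by linarith) (by linarith) le_rfl, fun k hk => ?_⟩
  exact or_iff_not_imp_left.2 fun hkτ =>
    hτ.not_isHighEnergyIn hω (by linarith) (hθ.mem_Icc hk) hkτ
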